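/- **Setting.** Let $\mathcal H$ be a separable real Hilbert space and let $\rho$ be a probability measure on $\mathcal H\times\mathbb R$ with marginal $\rho_{\mathcal H}$ on $\mathcal H$ and conditional distributions $\rho(\cdot|x)$. Assume that there are $M,\kappa\in\,]0,+\infty[$ with $|y|\le M$ for $\rho$-almost every $(x,y)$ and $\|x\|^2\le\kappa$ for $\rho_{\mathcal H}$-almost every $x$. Let $\mathcal E(w)=\int(\langle w,x\rangle-y)^2\,d\rho(x,y)$ for $w\in\mathcal H$, let $\|\cdot\|_\rho$ be the norm of $L^2(\mathcal H,\rho_{\mathcal H})$, and let $f_\rho(x)=\int y\,d\rho(y|x)$. Let $\overline{\mathcal L_\rho}$ be the closure in $L^2(\mathcal H,\rho_{\mathcal H})$ of the set $\mathcal L_\rho$ of the functions that are $\rho_{\mathcal H}$-a.s. equal to $\langle w,\cdot\rangle$ for some $w\in\mathcal H$, let $g_\rho=\operatorname{argmin}_{h\in\overline{\mathcal L_\rho}}\|f_\rho-h\|_\rho$, and let $L$ be the (positive, self-adjoint, compact) operator $Lf(x)=\int\langle x,x'\rangle f(x')\,d\rho_{\mathcal H}(x')$ on $L^2(\mathcal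 H,\rho_{\mathcal H})$. Let $n\in\mathbb N$, $n\ge 1$, and let $(x_1,y_1),\dots,(x_n,y_n)$ be independent random variables with law $\rho$. For a step size $\gamma>0$ define $\hat w_0=0$ and, for $t\in\mathbb N$, $\hat w_{t+1}=\hat u_t^n$, where $$\hat u_t^0=\hat w_t,\qquad \hat u_t^i=\hat u_t^{i-1}-\frac{\gamma}{n}\big(\langle \hat u_t^{i-1},x_i\rangle-y_i\big)x_i,\quad i=1,\dots,n.$$ **Theorem (finite sample bounds for the risk, non-attainable case).** Let $\gamma\in\,]0,\kappa^{-1}]$, let $r\in\,]0,1/2]$, let $g\in L^2(\mathcal H,\rho_{\mathcal H})$ be such that $g_\rho=L^rg$, and let $\delta\in\,]0,1[$. Then: 1. For every integer $t\ge1$, with probability greater than $1-\delta$, $$\mathcal E(\hat w_t)-\inf_{\mathcal H}\mathcal E\le \frac{8\big(32\log(16/\delta)\big)^2}{n}\left[\left(M+2M^2\kappa^{-1/2}+\frac{6\|g\|_\rho\kappa^{-1/2}}{3-2r}\right)t^{3/2-r}+3\kappa^r\,\frac{1-2r}{3-2r}\,\|g\|_\rho\right]^2+2\left(\frac{r}{\gamma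 t}\right)^{2r}\|g\|_\rho^2 .$$ 2. For the stopping rule $t^*(n)=\lceil n^{1/3}\rceil$, with probability greater than $1-\delta$, $$\mathcal E(\hat w_{t^*(n)})-\inf_{\mathcal H}\mathcal E\le\left[8\Big(32\log\frac{16}{\delta}\Big)^2\left(M+2M^2\kappa^{-1/2}+\frac{6\|g\|_\rho}{3-2r}+\frac{3-6r}{3-2r}\,\kappa^r\|g\|_\rho\right)^2+2\left(\frac r\gamma\right)^{2r}\|g\|_\rho^2\right]n^{-2r/3}.$$ -/

import Mathlib

open MeasureTheory ProbabilityTheory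
open scoped RealInnerProductSpace ENNReal

namespace IncrementalLearning

noncomputable section

section Setting

variable {H : Type*} [NormedAddCommGroup H] [InnerProductSpace ℝ H] [MeasurableSpace H]

/-- The risk `𝓔(w) = ∫ (⟪w, x⟫ - y)² dρ(x, y)` of the square loss. -/
def risk (ρ : Measure (H × ℝ)) (w : H) : ℝ :=
  ∫ z, (⟪w, z.1⟫ - z.2) ^ 2 ∂ρ

/-- The regression function `f_ρ(x) = ∫ y dρ(y | x)`, where `ρ(· | x)` is the conditional
distribution on `ℝ` given `x`. -/
def regressionFunction (ρ : Measure (H × ℝ)) [IsFiniteMeasure ρ] (x : H) : ℝ :=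
  ∫ y, y ∂(ρ.condKernel x)

/-- The space `𝓛_ρ` of (classes of) linear functions `⟪w, ·⟫`, `w ∈ H`, inside `L²(H, μ)`. -/
def linearFunctions (μ : Measure H) : Set (Lp ℝ 2 μ) :=
  {f | ∃ w : H, f =ᵐ[μ] fun x => ⟪w, x⟫}

/-- `h` is the best approximation `g_ρ` of the regression function in the `L²`-closure of the
space of linear functions: it minimizes `‖f_ρ - h‖_ρ` over that closure. -/
def IsBestLinearApprox (ρ : Measure (H × ℝ)) [IsFiniteMeasure ρ] (h : Lp ℝ 2 ρ.fst) : Prop :=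
  h ∈ closure (linearFunctions ρ.fst) ∧
    ∀ h' ∈ closure (linearFunctions ρ.fst),
      eLpNorm (fun x => regressionFunction ρ x - h x) 2 ρ.fst ≤
        eLpNorm (fun x => regressionFunction ρ x - h' x) 2 ρ.fst

end Setting

section IntegralOperator

theorem integrable_smul_self {H : Type*} [NormedAddCommGroup H] [InnerProductSpace ℝ H]
    [MeasurableSpace H] {μ : Measure H} (hμ : MemLp (fun x : H => x) 2 μ)
    (f : Lp ℝ 2 μ) : Integrable (fun x => f x • x) μ := by
  have := hμ.smul (r := 1) (Lp.memLp f)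
  exact memLp_one_iff_integrable.1 this

variable {H : Type*} [NormedAddCommGroup H] [InnerProductSpace ℝ H] [CompleteSpace H]
  [MeasurableSpace H]

theorem integral_kernel_eq {μ : Measure H} (hμ : MemLp (fun x : H => x) 2 μ)
    (f : Lp ℝ 2 μ) (x : H) :
    ∫ x', ⟪x, x'⟫ * f x' ∂μ = ⟪x, ∫ x', f x' • x' ∂μ⟫ := by
  rw [← integral_inner (integrable_smul_self hμ f)]
  simp [inner_smul_right, mul_comm]

theorem memLp_kernel {μ : Measure H} (hμ : MemLp (fun x : H => x) 2 μ)
    (f : Lp ℝ 2 μ) : MemLp (fun x => ∫ x', ⟪x, x'⟫ * f x' ∂μ) 2 μ := by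
  simp_rw [integral_kernel_eq hμ f]
  exact hμ.inner_const _

theorem norm_kernel_le {μ : Measure H} (hμ : MemLp (fun x : H => x) 2 μ)
    (f : Lp ℝ 2 μ) :
    ‖(memLp_kernel hμ f).toLp‖ ≤ (eLpNorm (fun x : H => x) 2 μ).toReal ^ 2 * ‖f‖ := by
  have hv : ‖∫ x', f x' • x' ∂μ‖ ≤ (eLpNorm (fun x : H => x) 2 μ).toReal * ‖f‖ := by
    have h1 : eLpNorm (fun x => f x • x) 1 μ ≤ eLpNorm f 2 μ * eLpNorm (fun x : H => x) 2 μ :=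
      eLpNorm_smul_le_mul_eLpNorm hμ.1 (Lp.memLp f).1
    have h2 := norm_integral_le_lintegral_norm (μ := μ) (fun x => f x • x)
    refine h2.trans ?_
    rw [Lp.norm_def, mul_comm, ← ENNReal.toReal_mul]
    refine ENNReal.toReal_mono (ENNReal.mul_ne_top (Lp.memLp f).2.ne hμ.2.ne) ?_
    refine le_trans (le_of_eq ?_) h1
    rw [eLpNorm_one_eq_lintegral_enorm]
    simp only [ofReal_norm]
  have hfin : (0 : ℝ) ≤ (eLpNorm (fun x : H => x) 2 μ).toReal := ENNReal.toReal_nonneg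
  set v := ∫ x', f x' • x' ∂μ with hvd
  have h3 : ‖(memLp_kernel hμ f).toLp‖ ≤ ‖v‖ * ‖hμ.toLp‖ := by
    refine Lp.norm_le_mul_norm_of_ae_le_mul ?_
    filter_upwards [(memLp_kernel hμ f).coeFn_toLp, hμ.coeFn_toLp] with x h1 h2
    rw [h1, h2, integral_kernel_eq hμ f, ← hvd]
    exact (norm_inner_le_norm _ _).trans (le_of_eq (mul_comm _ _))
  rw [Lp.norm_toLp] at h3
  rw [Lp.norm_toLp] at *
  nlinarith

/-- The integral operator with kernel `⟪x, x'⟫` on `L²(H, μ)`, for `μ` with finite second moment. -/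
def kernelOp (μ : Measure H) (hμ : MemLp (fun x : H => x) 2 μ) :
    Lp ℝ 2 μ →L[ℝ] Lp ℝ 2 μ :=
  LinearMap.mkContinuous
    { toFun := fun f => (memLp_kernel hμ f).toLp
      map_add' := by
        intro f g
        rw [← MemLp.toLp_add]
        refine MemLp.toLp_congr _ _ (Filter.Eventually.of_forall fun x => ?_)
        simp only [Pi.add_apply, integral_kernel_eq hμ]
        rw [← inner_add_right, ← integral_add (integrable_smul_self hμ f)
          (integrable_smul_self hμ g)]
        congr 1
        refine integral_congr_ae ?_
        filter_upwards [Lp.coeFn_add f g] with x hx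
        rw [hx, Pi.add_apply, add_smul]
      map_smul' := by
        intro c f
        rw [RingHom.id_apply, ← MemLp.toLp_const_smul]
        refine MemLp.toLp_congr _ _ (Filter.Eventually.of_forall fun x => ?_)
        simp only [Pi.smul_apply, integral_kernel_eq hμ]
        rw [smul_eq_mul, ← inner_smul_right, ← integral_smul]
        congr 1
        refine integral_congr_ae ?_
        filter_upwards [Lp.coeFn_smul c f] with x hx
        rw [hx, Pi.smul_apply, smul_assoc] }
    ((eLpNorm (fun x : H => x) 2 μ).toReal ^ 2) (norm_kernel_le hμ)

open Classical in
/-- The operator `L` on `L²(H, μ)`, `(L f)(x) = ∫ ⟪x, x'⟫ f(x') dμ(x')`. It is the kernel operator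
when `μ` has a finite second moment (in particular when `‖x‖²` is essentially bounded), and `0`
by convention otherwise. -/
def integralOperator (μ : Measure H) : Lp ℝ 2 μ →L[ℝ] Lp ℝ 2 μ :=
  if hμ : MemLp (fun x : H => x) 2 μ then kernelOp μ hμ else 0

theorem integralOperator_ae_eq {μ : Measure H} (hμ : MemLp (fun x : H => x) 2 μ)
    (f : Lp ℝ 2 μ) :
    integralOperator μ f =ᵐ[μ] fun x => ∫ x', ⟪x, x'⟫ * f x' ∂μ := by
  rw [integralOperator, dif_pos hμ]
  exact (memLp_kernel hμ f).coeFn_toLp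

end IntegralOperator

section FractionalPower

variable {F : Type*} [NormedAddCommGroup F] [InnerProductSpace ℝ F] [CompleteSpace F]

/-- The fractional power `T ^ r` of a compact positive self-adjoint operator `T`, by its spectral
decomposition: `T ^ r g = ∑ σ ^ r • P_σ g`, the sum over the eigenvalues `σ` of `T`, where `P_σ` is
the orthogonal projection onto the eigenspace `ker (T - σ)`. All the terms whose `σ` is not an
eigenvalue are zero. -/
def fractionalPower (T : F →L[ℝ] F) (r : ℝ) (g : F) : F :=
  ∑' σ : ℝ, σ ^ r • (T - σ • ContinuousLinearMap.id ℝ F).ker.starProjection g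

end FractionalPower

section SourceCondition

variable {H : Type*} [NormedAddCommGroup H] [InnerProductSpace ℝ H] [CompleteSpace H]
  [MeasurableSpace H]

/-- The source condition `g_ρ = L ^ r g`. -/
def SourceCondition (ρ : Measure (H × ℝ)) [IsFiniteMeasure ρ] (r : ℝ)
    (g : Lp ℝ 2 ρ.fst) : Prop :=
  IsBestLinearApprox ρ (fractionalPower (integralOperator ρ.fst) r g)

end SourceCondition

section Algorithm

variable {H : Type*} [NormedAddCommGroup H] [InnerProductSpace ℝ H]

/-- One epoch of the incremental gradient iteration: starting from `w`, for `i = 1, …, n`,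
`u ↦ u - (γ / n) (⟪u, x_i⟫ - y_i) x_i`. -/
def epoch (γ : ℝ) {n : ℕ} (z : Fin n → H × ℝ) (w : H) : H :=
  Fin.foldl n (fun u i => u - ((γ / n) * (⟪u, (z i).1⟫ - (z i).2)) • (z i).1) w

/-- The iterate `ŵ_t` after `t` epochs, starting from `w₀`. -/
def iterate (γ : ℝ) {n : ℕ} (z : Fin n → H × ℝ) (w₀ : H) : ℕ → H
  | 0 => w₀
  | t + 1 => epoch γ z (iterate γ z w₀ t)

/-- The stopping rule `t*(n) = ⌈n^{1/3}⌉`. -/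
def stoppingRule (n : ℕ) : ℕ := ⌈(n : ℝ) ^ (1 / 3 : ℝ)⌉₊

end Algorithm

end

end IncrementalLearning

/-! Let `S w = ⟪w, ·⟫`, an operator from `H` to `L²(ρ_H)`. Then `L = S S†`, and by Pythagoras the
excess risk of `w` is at most `‖S w - g_ρ‖²`. The iterate `ŵ_t` is compared with `v`, the result of
`n t` gradient steps of size `η = γ / n` on the population problem, so that `‖S w - g_ρ‖ ≤ ‖S (w -
v)‖ + ‖S v - g_ρ‖`.

Bias: the residual `S v - g_ρ` equals `-(1 - η L) ^ (n t) L ^ r g`, and on each eigenspace `σ ^ r (1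
- η σ) ^ N ≤ (r / (η N)) ^ r` (`norm_pow_fractionalPower_le`).

Sample error: within an epoch the incremental and the population steps differ by sampling errors
that are added one at a time. Summation by parts (`norm_epoch_error_le`) turns them into partial
sums of centred independent terms, which are of order `√n` uniformly in `k ≤ n` by a dimension-free
maximal inequality (`measure_exists_le_norm_sum_le`). As the iterates grow at most like `√t`, epoch
`s` contributes an error of order `√(s + 1) / √n`. The remaining epochs damp it by `1 / √(γ (t -
s))` (`norm_apply_gradientOp_pow_mul_le`), and the sum over `s` is of order `t / √n`.

This rate is sharper than the claimed `t ^ (3/2 - r) / √n`, because `r ≤ 1/2` and `t ≥ 1`; the other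
terms in the claimed bracket are nonnegative and only give room. A single event of probability
greater than `1 - δ` serves all `t`. -/

namespace IncrementalLearning

/-! ### Maximal inequality for sums of bounded centred vectors in a Hilbert space. -/

section Concentration


/-- Gaussian-type exponential moment of the squared norm after adding a bounded centred vector. -/
theorem lintegral_exp_sq_norm_add_le {E : Type*} [MeasurableSpace E] {F : Type*}
    [NormedAddCommGroup F] [InnerProductSpace ℝ F] {ρ : Measure E} [IsProbabilityMeasure ρ] {ξ : E → F}
    (hξ : StronglyMeasurable ξ) (hmean : ∀ v : F, ∫ z, ⟪v, ξ z⟫ ∂ρ = 0) {B : ℝ} (hB : 0 ≤ B)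
    (hbound : ∀ᵐ z ∂ρ, ‖ξ z‖ ≤ B) {θ : ℝ} (hθ : 0 ≤ θ) (v : F) :
    ∫⁻ z, ENNReal.ofReal (Real.exp (θ * ‖v + ξ z‖ ^ 2)) ∂ρ ≤
      ENNReal.ofReal (Real.exp ((θ + 2 * θ ^ 2 * B ^ 2) * ‖v‖ ^ 2 + θ * B ^ 2)) := by
  -- Hoeffding's lemma in the direction `v`: after expanding the square, only the cross term `2 θ
  -- ⟪v, ξ⟫` needs an exponential moment.
  have hsub := hasSubgaussianMGF_of_mem_Icc_of_integral_eq_zero (X := fun z => ⟪v, ξ z⟫) (μ := ρ)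
    (a := -(‖v‖ * B)) (b := ‖v‖ * B)
    ((stronglyMeasurable_const.inner hξ).measurable.aemeasurable) (by
      filter_upwards [hbound] with z hz
      exact abs_le.1 ((abs_real_inner_le_norm _ _).trans (by gcongr))) (hmean v)
  have h1 := hsub.mgf_le (2 * θ)
  have hint := hsub.integrable_exp_mul (2 * θ)
  have hc : ((‖‖v‖ * B - -(‖v‖ * B)‖₊ / 2 : NNReal) : ℝ) = ‖v‖ * B := by
    have : 0 ≤ ‖v‖ * B := by positivity
    push_cast
    rw [Real.norm_of_nonneg (by linarith)]
    ring
  push_cast at h1 hc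
  rw [hc] at h1
  calc ∫⁻ z, ENNReal.ofReal (Real.exp (θ * ‖v + ξ z‖ ^ 2)) ∂ρ
      ≤ ∫⁻ z, ENNReal.ofReal (Real.exp (θ * ‖v‖ ^ 2 + θ * B ^ 2) *
          Real.exp (2 * θ * ⟪v, ξ z⟫)) ∂ρ := by
        refine lintegral_mono_ae ?_
        filter_upwards [hbound] with z hz
        refine ENNReal.ofReal_le_ofReal ?_
        rw [← Real.exp_add, Real.exp_le_exp, norm_add_sq_real]
        have : ‖ξ z‖ ^ 2 ≤ B ^ 2 := by gcongr
        nlinarith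
    _ = ENNReal.ofReal (Real.exp (θ * ‖v‖ ^ 2 + θ * B ^ 2) *
          mgf (fun z => ⟪v, ξ z⟫) ρ (2 * θ)) := by
        rw [← ofReal_integral_eq_lintegral_ofReal (hint.const_mul _)
          (Filter.Eventually.of_forall fun z => by positivity), integral_const_mul, mgf]
    _ ≤ _ := by
        refine ENNReal.ofReal_le_ofReal ?_
        calc _ ≤ Real.exp (θ * ‖v‖ ^ 2 + θ * B ^ 2) *
              Real.exp ((‖v‖ * B) ^ 2 * (2 * θ) ^ 2 / 2) := by gcongr
          _ = _ := by
            rw [← Real.exp_add]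
            congr 1
            ring

/-- The partial sums of `ξ (z j)`, stopped when their norm reaches `s`. -/
noncomputable def stoppedSum {E F : Type*} [NormedAddCommGroup F] (ξ : E → F) (s : ℝ) : (k : ℕ) → (Fin k → E) → F
  | 0, _ => 0
  | k + 1, z =>
    stoppedSum ξ s k (Fin.init z) +
      if ‖stoppedSum ξ s k (Fin.init z)‖ < s then ξ (z (Fin.last k)) else 0

theorem measurable_fin_init {E : Type*} [MeasurableSpace E] (k : ℕ) :
    Measurable (Fin.init : (Fin (k + 1) → E) → (Fin k → E)) :=
  measurable_pi_lambda _ fun i => measurable_pi_apply i.castSucc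

theorem stronglyMeasurable_stoppedSum {E : Type*} [MeasurableSpace E] {F : Type*} [NormedAddCommGroup F]
    {ξ : E → F} (hξ : StronglyMeasurable ξ) (s : ℝ) (k : ℕ) :
    StronglyMeasurable (stoppedSum ξ s k) := by
  induction k with
  | zero => exact stronglyMeasurable_const
  | succ k ih =>
    have h1 := ih.comp_measurable (measurable_fin_init (E := E) k)
    refine h1.add (StronglyMeasurable.ite (p := fun z : Fin (k + 1) → E =>
      ‖stoppedSum ξ s k (Fin.init z)‖ < s) ?_ ?_ stronglyMeasurable_const)
    · exact measurableSet_lt h1.norm.measurable measurable_const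
    · exact hξ.comp_measurable (measurable_pi_apply _)

/-- Once the norm reaches `s` the stopped sum is frozen there. Its final value therefore records the
maximum over all partial sums, and a tail bound at time `n` becomes a maximal inequality. -/
theorem norm_sum_lt_of_norm_stoppedSum_lt {E F : Type*} [NormedAddCommGroup F]
    {ξ : E → F} {s : ℝ} {n : ℕ} {z : Fin n → E}
    (h : ‖stoppedSum ξ s n z‖ < s) :
    stoppedSum ξ s n z = ∑ j, ξ (z j) ∧
      ∀ k (hk : k ≤ n), ‖∑ j : Fin k, ξ (z (Fin.castLE hk j))‖ < s := by
  induction n with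
  | zero =>
    refine ⟨by simp [stoppedSum], fun k hk => ?_⟩
    obtain rfl : k = 0 := by omega
    simpa [stoppedSum] using h
  | succ n ih =>
    have h' : ‖stoppedSum ξ s n (Fin.init z)‖ < s := by
      by_contra hcon
      simp only [stoppedSum, hcon, if_false, add_zero] at h
    have heq : stoppedSum ξ s (n + 1) z = ∑ j, ξ (z j) := by
      rw [stoppedSum, if_pos h', (ih h').1, Fin.sum_univ_castSucc]
      rfl
    refine ⟨heq, fun k hk => ?_⟩
    rcases Nat.lt_or_ge n k with hk' | hk'
    · obtain rfl : k = n + 1 := by omega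
      rw [heq] at h
      exact h
    · exact (ih h').2 k hk'

/-- A new summand raises the exponent weight from `θ` to `θ + 2 θ² B²`. The weights `1 / (B² (a + 2
k))` decrease fast enough in `k` to absorb this, so each step costs only a factor `exp (θ B²) ≤ exp
(1 / a)`. -/
theorem lintegral_exp_sq_norm_stoppedSum_le {E : Type*} [MeasurableSpace E] {F : Type*}
    [NormedAddCommGroup F] [InnerProductSpace ℝ F] {ρ : Measure E} [IsProbabilityMeasure ρ] {ξ : E → F}
    (hξ : StronglyMeasurable ξ) (hmean : ∀ v : F, ∫ z, ⟪v, ξ z⟫ ∂ρ = 0) {B : ℝ} (hB : 0 < B)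
    (hbound : ∀ᵐ z ∂ρ, ‖ξ z‖ ≤ B) (s : ℝ) {a : ℝ} (ha : 0 < a) (k : ℕ) :
    ∫⁻ z, ENNReal.ofReal (Real.exp (1 / (B ^ 2 * (a + 2 * k)) * ‖stoppedSum ξ s k z‖ ^ 2))
        ∂(Measure.pi fun _ : Fin k => ρ) ≤
      ENNReal.ofReal (Real.exp (k / a)) := by
  induction k with
  | zero => simp [stoppedSum]
  | succ k ih =>
    have hmp := (measurePreserving_piFinSuccAbove (fun _ : Fin (k + 1) => ρ) (Fin.last k)).symm
    have hmeas : Measurable fun z : Fin (k + 1) → E =>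
        ENNReal.ofReal (Real.exp (1 / (B ^ 2 * (a + 2 * ((k + 1 : ℕ) : ℝ))) *
          ‖stoppedSum ξ s (k + 1) z‖ ^ 2)) := by
      have := (stronglyMeasurable_stoppedSum hξ s (k + 1)).norm.measurable
      fun_prop
    rw [← hmp.lintegral_comp hmeas]
    refine (lintegral_prod_symm' _ (hmeas.comp (MeasurableEquiv.measurable _))).trans_le ?_
    set θ := 1 / (B ^ 2 * (a + 2 * ((k + 1 : ℕ) : ℝ))) with hθ
    have hθ0 : 0 ≤ θ := by positivity
    have hθB : θ * B ^ 2 ≤ 1 / a := by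
      rw [hθ, one_div_mul_eq_div, div_le_div_iff₀ (by positivity) ha]
      push_cast
      nlinarith [sq_nonneg B, (Nat.cast_nonneg k : (0 : ℝ) ≤ k), sq_pos_of_pos hB]
    -- With `p = a + 2 k` this is `p (p + 4) ≤ (p + 2) ^ 2`.
    have hθstep : θ + 2 * θ ^ 2 * B ^ 2 ≤ 1 / (B ^ 2 * (a + 2 * k)) := by
      have hp : (0 : ℝ) < a + 2 * k := by positivity
      have h2 : θ + 2 * θ ^ 2 * B ^ 2 = (a + 2 * k + 4) / (B ^ 2 * (a + 2 * k + 2) ^ 2) := by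
        rw [hθ]
        push_cast
        field_simp
        ring
      rw [h2, div_le_div_iff₀ (by positivity) (by positivity)]
      nlinarith [sq_pos_of_pos hB]
    calc _ ≤ ∫⁻ w : Fin k → E, ENNReal.ofReal (Real.exp (1 / a)) *
          ENNReal.ofReal (Real.exp (1 / (B ^ 2 * (a + 2 * k)) * ‖stoppedSum ξ s k w‖ ^ 2))
          ∂(Measure.pi fun _ : Fin k => ρ) := by
          refine lintegral_mono fun w => ?_
          rw [← ENNReal.ofReal_mul (by positivity), ← Real.exp_add]
          have hinit : ∀ x : E, Fin.init ((MeasurableEquiv.piFinSuccAbove (fun _ : Fin (k + 1) => E)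
              (Fin.last k)).symm (x, w)) = w := by
            intro x
            ext i
            simp [MeasurableEquiv.piFinSuccAbove, Fin.init]
          have hlast : ∀ x : E, ((MeasurableEquiv.piFinSuccAbove (fun _ : Fin (k + 1) => E)
              (Fin.last k)).symm (x, w)) (Fin.last k) = x := by
            intro x
            simp [MeasurableEquiv.piFinSuccAbove]
          simp only [Function.comp_def, stoppedSum, hinit, hlast]
          by_cases hs : ‖stoppedSum ξ s k w‖ < s
          · simp only [hs, if_true]
            refine (lintegral_exp_sq_norm_add_le hξ hmean hB.le hbound hθ0 _).trans ?_
            refine ENNReal.ofReal_le_ofReal (Real.exp_le_exp.2 ?_)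
            rw [add_comm (1 / a)]
            gcongr
          · simp only [hs, if_false, add_zero, lintegral_const, measure_univ, mul_one]
            refine ENNReal.ofReal_le_ofReal (Real.exp_le_exp.2 ?_)
            have h3 : θ ≤ 1 / (B ^ 2 * (a + 2 * k)) := le_trans (by
              have : 0 ≤ 2 * θ ^ 2 * B ^ 2 := by positivity
              linarith) hθstep
            have h4 : 0 ≤ 1 / a := by positivity
            have h5 := mul_le_mul_of_nonneg_right h3 (sq_nonneg ‖stoppedSum ξ s k w‖)
            linarith
      _ ≤ _ := by
          have := (stronglyMeasurable_stoppedSum hξ s k).norm.measurable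
          rw [lintegral_const_mul _ (by fun_prop)]
          refine (mul_le_mul_right ih _).trans (le_of_eq ?_)
          rw [← ENNReal.ofReal_mul (by positivity), ← Real.exp_add]
          push_cast
          congr 2
          ring

/-- A dimension-free maximal inequality for sums of independent, bounded, centred random vectors
of an inner product space. -/
theorem measure_exists_le_norm_sum_le {E : Type*} [MeasurableSpace E] {F : Type*}
    [NormedAddCommGroup F] [InnerProductSpace ℝ F] {ρ : Measure E} [IsProbabilityMeasure ρ] {ξ : E → F}
    (hξ : StronglyMeasurable ξ) (hmean : ∀ v : F, ∫ z, ⟪v, ξ z⟫ ∂ρ = 0) {B : ℝ} (hB : 0 < B)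
    (hbound : ∀ᵐ z ∂ρ, ‖ξ z‖ ≤ B) {n : ℕ} (hn : 1 ≤ n) {s : ℝ} (hs : 0 ≤ s) :
    (Measure.pi fun _ : Fin n => ρ)
        {z | ∃ k, ∃ hk : k ≤ n, s ≤ ‖∑ j : Fin k, ξ (z (Fin.castLE hk j))‖} ≤
      ENNReal.ofReal (Real.exp (1 / 2 - s ^ 2 / (4 * n * B ^ 2))) := by
  have hn' : (0 : ℝ) < n := by exact_mod_cast hn
  -- The choice `a = 2 n` makes the accumulated factor `exp (1 / 2)` and the final weight `1 / (4 n
  -- B²)`.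
  have hE := lintegral_exp_sq_norm_stoppedSum_le hξ hmean hB hbound s (a := 2 * n)
    (by positivity) n
  have hR := (stronglyMeasurable_stoppedSum hξ s n).norm.measurable
  set c : ℝ := 1 / (B ^ 2 * (2 * n + 2 * n)) with hc
  have hc0 : 0 ≤ c := by positivity
  have hM := mul_meas_ge_le_lintegral (μ := Measure.pi fun _ : Fin n => ρ)
    (f := fun z => ENNReal.ofReal (Real.exp (c * ‖stoppedSum ξ s n z‖ ^ 2))) (by fun_prop)
    (ENNReal.ofReal (Real.exp (c * s ^ 2)))
  have hsub : {z : Fin n → E | ∃ k, ∃ hk : k ≤ n, s ≤ ‖∑ j : Fin k, ξ (z (Fin.castLE hk j))‖} ⊆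
      {z | ENNReal.ofReal (Real.exp (c * s ^ 2)) ≤
        ENNReal.ofReal (Real.exp (c * ‖stoppedSum ξ s n z‖ ^ 2))} := by
    rintro z ⟨k, hk, hz⟩
    refine ENNReal.ofReal_le_ofReal (Real.exp_le_exp.2 ?_)
    have : s ≤ ‖stoppedSum ξ s n z‖ := by
      by_contra hcon
      exact absurd hz (not_le.2 ((norm_sum_lt_of_norm_stoppedSum_lt (not_le.1 hcon)).2 k hk))
    gcongr
  refine (measure_mono hsub).trans ?_
  have h6 : ENNReal.ofReal (Real.exp (1 / 2 - s ^ 2 / (4 * n * B ^ 2))) =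
      ENNReal.ofReal (Real.exp (n / (2 * n))) / ENNReal.ofReal (Real.exp (c * s ^ 2)) := by
    rw [← ENNReal.ofReal_div_of_pos (by positivity), ← Real.exp_sub]
    congr 3
    · field_simp
    · rw [hc]
      field_simp
      ring
  rw [h6, ENNReal.le_div_iff_mul_le (Or.inl (by positivity)) (Or.inl ENNReal.ofReal_ne_top),
    mul_comm]
  exact hM.trans hE

theorem measure_exists_le_norm_sum_sub_integral_le {E : Type*} [MeasurableSpace E] {F : Type*}
    [NormedAddCommGroup F] [InnerProductSpace ℝ F] [CompleteSpace F] {ρ : Measure E}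
    [IsProbabilityMeasure ρ] {f : E → F} (hf : StronglyMeasurable f) {B : ℝ} (hB : 0 < B)
    (hbound : ∀ᵐ z ∂ρ, ‖f z‖ ≤ B) {n : ℕ} (hn : 1 ≤ n) {ℓ : ℝ} (hℓ : 0 ≤ ℓ) :
    (Measure.pi fun _ : Fin n => ρ) {z | ∃ k, ∃ hk : k ≤ n,
        4 * √ℓ * B * √n ≤ ‖∑ j : Fin k, (f (z (Fin.castLE hk j)) - ∫ z, f z ∂ρ)‖} ≤
      ENNReal.ofReal (Real.exp (1 / 2 - ℓ)) := by
  have hn0 : (0 : ℝ) < n := by exact_mod_cast hn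
  have hint : Integrable f ρ := Integrable.of_bound hf.aestronglyMeasurable B hbound
  have hmean : ∀ v, ∫ z, ⟪v, f z - ∫ z, f z ∂ρ⟫ ∂ρ = 0 := by
    intro v
    simp only [inner_sub_right]
    rw [integral_sub (hint.const_inner v) (integrable_const _), integral_inner hint]
    simp
  have hbound' : ∀ᵐ z ∂ρ, ‖f z - ∫ z, f z ∂ρ‖ ≤ 2 * B := by
    have h1 := norm_integral_le_of_norm_le_const hbound
    rw [probReal_univ, mul_one] at h1
    filter_upwards [hbound] with z hz
    exact (norm_sub_le _ _).trans (by linarith)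
  -- Centring doubles the bound to `2 B`; the level `4 √ℓ B √n` then makes the exponent exactly `ℓ`.
  have main := measure_exists_le_norm_sum_le (hf.sub stronglyMeasurable_const) hmean
    (by positivity) hbound' hn (s := 4 * √ℓ * B * √n) (by positivity)
  have hexp : (4 * √ℓ * B * √n) ^ 2 / (4 * n * (2 * B) ^ 2) = ℓ := by
    rw [mul_pow, mul_pow, mul_pow, Real.sq_sqrt hℓ, Real.sq_sqrt hn0.le]
    field_simp
    ring
  rwa [hexp] at main

end Concentration

/-! ### Contraction and smoothing by population gradient steps. -/

section GradientOperator

variable {H G : Type*} [NormedAddCommGroup H] [InnerProductSpace ℝ H] [CompleteSpace H]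
  [NormedAddCommGroup G] [InnerProductSpace ℝ G] [CompleteSpace G]

/-- The linear part `1 - η S†S` of a gradient step of size `η` for `‖S w - f‖² / 2`. -/
noncomputable def gradientOp (S : H →L[ℝ] G) (η : ℝ) : H →L[ℝ] H :=
  ContinuousLinearMap.id ℝ H - η • (S.adjoint ∘L S)

theorem gradientOp_apply (S : H →L[ℝ] G) (η : ℝ) (v : H) :
    gradientOp S η v = v - η • S.adjoint (S v) := rfl

theorem mul_norm_sq_apply_le {H G : Type*} [NormedAddCommGroup H] [InnerProductSpace ℝ H]
    [NormedAddCommGroup G] [InnerProductSpace ℝ G] {S : H →L[ℝ] G} {η : ℝ} (hη : 0 ≤ η) (hS : η * ‖S‖ ^ 2 ≤ 1) (v : H) :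
    η * ‖S v‖ ^ 2 ≤ ‖v‖ ^ 2 := by
  have h1 : ‖S v‖ ^ 2 ≤ (‖S‖ * ‖v‖) ^ 2 := by
    gcongr
    exact S.le_opNorm v
  nlinarith [mul_le_mul_of_nonneg_left h1 hη, sq_nonneg ‖v‖]

theorem norm_sq_apply_gradientOp (S : H →L[ℝ] G) (η : ℝ) (v : H) :
    ‖S (gradientOp S η v)‖ ^ 2 = ‖S v‖ ^ 2 - 2 * η * ‖S.adjoint (S v)‖ ^ 2 +
      η ^ 2 * ‖S (S.adjoint (S v))‖ ^ 2 := by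
  rw [gradientOp_apply, map_sub, map_smul, norm_sub_sq_real, real_inner_smul_right,
    ← ContinuousLinearMap.adjoint_inner_left, real_inner_self_eq_norm_sq, norm_smul, mul_pow,
    Real.norm_eq_abs, sq_abs]
  ring

theorem norm_apply_gradientOp_le {S : H →L[ℝ] G} {η : ℝ} (hη : 0 ≤ η) (hS : η * ‖S‖ ^ 2 ≤ 1)
    (v : H) : ‖S (gradientOp S η v)‖ ≤ ‖S v‖ := by
  refine (sq_le_sq₀ (norm_nonneg _) (norm_nonneg _)).1 ?_
  have := mul_norm_sq_apply_le hη hS (S.adjoint (S v))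
  rw [norm_sq_apply_gradientOp]
  nlinarith [mul_le_mul_of_nonneg_left this hη, mul_nonneg hη (sq_nonneg ‖S.adjoint (S v)‖)]

/-- Expanding both squares, the terms in `‖S v‖²` cancel and `-η² (‖a‖² - η ‖S a‖²)` with `a = S† S
v` remains, which is nonpositive. Keeping both `S`-terms gives the factor `2 m + 1` in the smoothing
estimate. -/
theorem norm_sq_gradientOp_add_le {S : H →L[ℝ] G} {η : ℝ} (hη : 0 ≤ η) (hS : η * ‖S‖ ^ 2 ≤ 1)
    (v : H) :
    ‖gradientOp S η v‖ ^ 2 + η * ‖S v‖ ^ 2 + η * ‖S (gradientOp S η v)‖ ^ 2 ≤ ‖v‖ ^ 2 := by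
  have h1 : ‖gradientOp S η v‖ ^ 2 =
      ‖v‖ ^ 2 - 2 * η * ‖S v‖ ^ 2 + η ^ 2 * ‖S.adjoint (S v)‖ ^ 2 := by
    rw [gradientOp_apply, norm_sub_sq_real, real_inner_smul_right,
      ContinuousLinearMap.adjoint_inner_right, real_inner_self_eq_norm_sq, norm_smul, mul_pow,
      Real.norm_eq_abs, sq_abs]
    ring
  have h2 := mul_norm_sq_apply_le hη hS (S.adjoint (S v))
  rw [norm_sq_apply_gradientOp, h1]
  nlinarith [mul_le_mul_of_nonneg_left h2 (sq_nonneg η)]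

theorem norm_gradientOp_apply_le {S : H →L[ℝ] G} {η : ℝ} (hη : 0 ≤ η) (hS : η * ‖S‖ ^ 2 ≤ 1)
    (v : H) : ‖gradientOp S η v‖ ≤ ‖v‖ := by
  refine (sq_le_sq₀ (norm_nonneg _) (norm_nonneg _)).1 ?_
  have := norm_sq_gradientOp_add_le hη hS v
  have : 0 ≤ η * ‖S v‖ ^ 2 := by positivity
  have : 0 ≤ η * ‖S (gradientOp S η v)‖ ^ 2 := by positivity
  linarith

theorem norm_apply_gradientOp_pow_le {S : H →L[ℝ] G} {η : ℝ} (hη : 0 ≤ η)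
    (hS : η * ‖S‖ ^ 2 ≤ 1) (m : ℕ) (v : H) : ‖S ((gradientOp S η ^ m) v)‖ ≤ ‖S v‖ := by
  induction m generalizing v with
  | zero => simp
  | succ m ih =>
    rw [pow_succ]
    exact (ih _).trans (norm_apply_gradientOp_le hη hS v)

/-- The smoothing property of the iterated gradient operator. -/
theorem mul_norm_sq_apply_gradientOp_pow_le {S : H →L[ℝ] G} {η : ℝ} (hη : 0 ≤ η)
    (hS : η * ‖S‖ ^ 2 ≤ 1) (m : ℕ) (v : H) :
    (2 * m + 1) * η * ‖S ((gradientOp S η ^ m) v)‖ ^ 2 ≤ ‖v‖ ^ 2 := by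
  induction m generalizing v with
  | zero => simpa using mul_norm_sq_apply_le hη hS v
  | succ m ih =>
    have h1 := ih (gradientOp S η v)
    have h2 := norm_sq_gradientOp_add_le hη hS v
    have h3 := norm_apply_gradientOp_pow_le hη hS m (gradientOp S η v)
    have h4 := norm_apply_gradientOp_le hη hS v
    rw [pow_succ (gradientOp S η), mul_apply_eq_comp, Nat.cast_succ]
    -- Both energies spent in the extra step dominate the final one, which supplies the increment `2
    -- η`.
    have h5 : ‖S ((gradientOp S η ^ m) (gradientOp S η v))‖ ^ 2 ≤
      ‖S (gradientOp S η v)‖ ^ 2 := by gcongr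
    have h6 : ‖S (gradientOp S η v)‖ ^ 2 ≤ ‖S v‖ ^ 2 := by gcongr
    nlinarith [mul_le_mul_of_nonneg_left h5 hη, mul_le_mul_of_nonneg_left h6 hη]

theorem norm_apply_gradientOp_pow_mul_le {S : H →L[ℝ] G} {γ : ℝ} (hγ : 0 < γ)
    (hS : γ * ‖S‖ ^ 2 ≤ 1) {n : ℕ} (hn : 1 ≤ n) (j : ℕ) (v : H) :
    ‖S ((gradientOp S (γ / n) ^ (n * j)) v)‖ ≤ ‖v‖ / √(γ * (j + 1)) := by
  have hn' : (1 : ℝ) ≤ n := by exact_mod_cast hn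
  have hη : 0 ≤ γ / n := by positivity
  have hηS : γ / n * ‖S‖ ^ 2 ≤ 1 := by
    refine le_trans ?_ hS
    gcongr
    exact div_le_self hγ.le hn'
  rw [le_div_iff₀ (by positivity)]
  refine (sq_le_sq₀ (by positivity) (by positivity)).1 ?_
  rw [mul_pow, Real.sq_sqrt (by positivity)]
  -- For `j ≥ 1`, `(2 n j + 1) γ / n ≥ 2 j γ ≥ (j + 1) γ`. For `j = 0` that estimate would lose a
  -- factor `n`, and `γ ‖S‖² ≤ 1` is used directly.
  rcases Nat.eq_zero_or_pos j with rfl | hj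
  · simpa [mul_comm] using mul_norm_sq_apply_le hγ.le hS v
  · have h1 := mul_norm_sq_apply_gradientOp_pow_le hη hηS (n * j) v
    have hj' : (1 : ℝ) ≤ j := by exact_mod_cast hj
    refine le_trans ?_ h1
    rw [mul_comm]
    refine mul_le_mul_of_nonneg_right ?_ (sq_nonneg _)
    push_cast
    have : (2 * (n * j : ℝ) + 1) * (γ / n) = γ * (2 * j) + γ / n := by
      field_simp
    rw [this]
    nlinarith

/-- Propagation of per-epoch errors through the iterated gradient operator. -/
theorem norm_apply_le_sum_of_perturbation {S : H →L[ℝ] G} {γ : ℝ} (hγ : 0 < γ)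
    (hS : γ * ‖S‖ ^ 2 ≤ 1) {n : ℕ} (hn : 1 ≤ n) {e : ℕ → H} {q : ℕ → ℝ} (he : e 0 = 0)
    (hq : ∀ s, ‖e (s + 1) - (gradientOp S (γ / n) ^ n) (e s)‖ ≤ q s) (t m : ℕ) :
    ‖S ((gradientOp S (γ / n) ^ (n * m)) (e t))‖ ≤
      ∑ s ∈ Finset.range t, q s / √(γ * (t + m - s)) := by
  -- The `m` trailing epochs make the induction close: peeling off the last epoch leaves the older
  -- errors with `m + 1` epochs still to pass through.
  induction t generalizing m with
  | zero => simp [he]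
  | succ t ih =>
    have h1 := ih (m + 1)
    have h2 := norm_apply_gradientOp_pow_mul_le hγ hS hn m
      (e (t + 1) - (gradientOp S (γ / n) ^ n) (e t))
    have h3 : S ((gradientOp S (γ / n) ^ (n * m)) (e (t + 1))) =
        S ((gradientOp S (γ / n) ^ (n * (m + 1))) (e t)) +
        S ((gradientOp S (γ / n) ^ (n * m)) (e (t + 1) - (gradientOp S (γ / n) ^ n) (e t))) := by
      rw [mul_add, mul_one, pow_add, mul_apply_eq_comp, ← map_add, ← map_add]
      congr 2
      abel
    rw [h3, Finset.sum_range_succ]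
    refine (norm_add_le _ _).trans (add_le_add (h1.trans (le_of_eq ?_)) (h2.trans ?_))
    · refine Finset.sum_congr rfl fun s _ => ?_
      push_cast
      congr 3
      ring
    · have : ((t + 1 : ℕ) : ℝ) + m - t = m + 1 := by
        push_cast
        ring
      rw [this]
      gcongr
      exact hq t

/-- The gradient iteration with step `η` for `‖S w - f‖² / 2`, `b = S† f`, started at `0`. -/
noncomputable def gradientSeq (S : H →L[ℝ] G) (η : ℝ) (b : H) : ℕ → H
  | 0 => 0
  | m + 1 => gradientOp S η (gradientSeq S η b m) + η • b

end GradientOperator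

/-! ### Growth of the incremental iterates. -/

section IncrementalStep

variable {H : Type*} [NormedAddCommGroup H] [InnerProductSpace ℝ H]

/-- The incremental gradient steps over the data `z 0, z 1, …`, started at `w`. -/
noncomputable def incrementalSeq (η : ℝ) (z : ℕ → H × ℝ) (w : H) : ℕ → H
  | 0 => w
  | i + 1 => incrementalSeq η z w i -
      (η * (⟪incrementalSeq η z w i, (z i).1⟫ - (z i).2)) • (z i).1

theorem foldl_eq_incrementalSeq (η : ℝ) (z : ℕ → H × ℝ) (w : H) (n : ℕ) :
    Fin.foldl n (fun u (i : Fin n) => u - (η * (⟪u, (z i).1⟫ - (z i).2)) • (z i).1) w =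
      incrementalSeq η z w n := by
  induction n with
  | zero => simp [incrementalSeq]
  | succ n ih =>
    rw [Fin.foldl_succ_last]
    simp only [Fin.val_castSucc, Fin.val_last, ih]
    rfl

/-- With `a = ⟪u, x⟫ - y`, the change is at most `η (a² - 2 a ⟪u, x⟫) = η (y² - ⟪u, x⟫²)`. Hence `n`
steps of size `γ / n` add at most `γ M²` to the squared norm. -/
theorem norm_sq_step_le {η M : ℝ} (hη : 0 ≤ η) {x : H} {y : ℝ} (hx : η * ‖x‖ ^ 2 ≤ 1)
    (hy : |y| ≤ M) (u : H) :
    ‖u - (η * (⟪u, x⟫ - y)) • x‖ ^ 2 ≤ ‖u‖ ^ 2 + η * M ^ 2 := by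
  have hy2 : y ^ 2 ≤ M ^ 2 := sq_le_sq.2 (hy.trans (le_abs_self M))
  rw [norm_sub_sq_real, real_inner_smul_right, norm_smul, mul_pow, Real.norm_eq_abs, sq_abs]
  have h1 : (η * (⟪u, x⟫ - y)) ^ 2 * ‖x‖ ^ 2 ≤ η * (⟪u, x⟫ - y) ^ 2 := by
    have := mul_le_mul_of_nonneg_left hx (mul_nonneg hη (sq_nonneg (⟪u, x⟫ - y)))
    nlinarith
  nlinarith [mul_nonneg hη (sq_nonneg ⟪u, x⟫), mul_le_mul_of_nonneg_left hy2 hη]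

theorem norm_step_sub_le {η M κ : ℝ} (hη : 0 ≤ η) {x : H} {y : ℝ}
    (hx : ‖x‖ ^ 2 ≤ κ) (hy : |y| ≤ M) (u : H) :
    ‖u - (η * (⟪u, x⟫ - y)) • x - u‖ ≤ η * (κ * ‖u‖ + √κ * M) := by
  have hx' : ‖x‖ ≤ √κ := Real.le_sqrt_of_sq_le hx
  rw [sub_sub_cancel_left, norm_neg, norm_smul, norm_mul, Real.norm_of_nonneg hη, mul_assoc]
  gcongr
  have h1 : ‖⟪u, x⟫ - y‖ ≤ ‖u‖ * ‖x‖ + M :=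
    (norm_sub_le _ _).trans (add_le_add (norm_inner_le_norm _ _) hy)
  calc _ ≤ (‖u‖ * ‖x‖ + M) * ‖x‖ := by gcongr
    _ = ‖x‖ ^ 2 * ‖u‖ + ‖x‖ * M := by ring
    _ ≤ _ := by
      have hM : 0 ≤ M := (abs_nonneg y).trans hy
      gcongr

theorem norm_sq_incrementalSeq_le {η M : ℝ} (hη : 0 ≤ η) {z : ℕ → H × ℝ} {n : ℕ}
    (hx : ∀ i < n, η * ‖(z i).1‖ ^ 2 ≤ 1) (hy : ∀ i < n, |(z i).2| ≤ M) (w : H) {i : ℕ}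
    (hi : i ≤ n) : ‖incrementalSeq η z w i‖ ^ 2 ≤ ‖w‖ ^ 2 + i * (η * M ^ 2) := by
  induction i with
  | zero => simp [incrementalSeq]
  | succ i ih =>
    have h1 := norm_sq_step_le hη (hx i (by omega)) (hy i (by omega)) (incrementalSeq η z w i)
    have h2 := ih (by omega)
    rw [incrementalSeq]
    push_cast
    linarith

end IncrementalStep

/-! ### Error of one epoch, by summation by parts. -/

section Epoch

variable {H G : Type*} [NormedAddCommGroup H] [InnerProductSpace ℝ H] [CompleteSpace H]
  [NormedAddCommGroup G] [InnerProductSpace ℝ G] [CompleteSpace G]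

/-- One epoch of incremental steps, compared with as many gradient steps: summation by parts
bounds the difference through the partial sums of the sampling errors. -/
theorem norm_epoch_error_le {S : H →L[ℝ] G} {η κ 𝔇 𝔡 U W : ℝ} (hη : 0 ≤ η) (hκ : 0 ≤ κ)
    (h𝔇 : 0 ≤ 𝔇) (hS : η * ‖S‖ ^ 2 ≤ 1) (hT : ∀ w, ‖S.adjoint (S w)‖ ≤ κ * ‖w‖) {b : H}
    {z : ℕ → H × ℝ} {n : ℕ}
    (hD : ∀ k ≤ n, ∀ w : H,
      ‖∑ j ∈ Finset.range k, (⟪w, (z j).1⟫ • (z j).1 - S.adjoint (S w))‖ ≤ 𝔇 * ‖w‖)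
    (hd : ∀ k ≤ n, ‖∑ j ∈ Finset.range k, ((z j).2 • (z j).1 - b)‖ ≤ 𝔡)
    {u v : ℕ → H} (hv : ∀ i, v (i + 1) = gradientOp S η (v i) + η • b)
    (hu : ∀ i, u (i + 1) = u i - (η * (⟪u i, (z i).1⟫ - (z i).2)) • (z i).1)
    (hU : ∀ i ≤ n, ‖u i‖ ≤ U) (hW : ∀ i < n, ‖u (i + 1) - u i‖ ≤ η * W) :
    ‖u n - v n - (gradientOp S η ^ n) (u 0 - v 0)‖ ≤
      η * (𝔇 * U + 𝔡) + n * (η ^ 2 * κ * (𝔇 * U + 𝔡) + η ^ 2 * 𝔇 * W) := by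
  set D : ℕ → H → H := fun k w =>
    ∑ j ∈ Finset.range k, (⟪w, (z j).1⟫ • (z j).1 - S.adjoint (S w)) with hDdef
  set d : ℕ → H := fun k => ∑ j ∈ Finset.range k, ((z j).2 • (z j).1 - b) with hddef
  have hDsucc : ∀ k w, D (k + 1) w = D k w + (⟪w, (z k).1⟫ • (z k).1 - S.adjoint (S w)) :=
    fun k w => Finset.sum_range_succ _ _
  have hdsucc : ∀ k, d (k + 1) = d k + ((z k).2 • (z k).1 - b) :=
    fun k => Finset.sum_range_succ _ _
  have hDsub : ∀ k w w', D k (w - w') = D k w - D k w' := by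
    intro k w w'
    simp only [hDdef]
    rw [← Finset.sum_sub_distrib]
    refine Finset.sum_congr rfl fun j _ => ?_
    rw [inner_sub_left, map_sub, map_sub]
    module
  have hDd : ∀ i ≤ n, ‖D i (u i) - d i‖ ≤ 𝔇 * U + 𝔡 := fun i hi =>
    (norm_sub_le _ _).trans (add_le_add ((hD i hi _).trans (by gcongr; exact hU i hi)) (hd i hi))
  -- The corrector `η (D i (u i) - d i)` absorbs the first-order sampling error. What remains at
  -- each step is of order `η²`, since the increments of `u` are of order `η`.
  set h : ℕ → H := fun i => u i - v i + η • (D i (u i) - d i) with hh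
  have hstep : ∀ i, h (i + 1) = gradientOp S η (h i) +
      ((η ^ 2) • S.adjoint (S (D i (u i) - d i)) + η • D (i + 1) (u (i + 1) - u i)) := by
    intro i
    rw [hDsub]
    simp only [hh, hv i, hDsucc i (u i), hdsucc i, gradientOp_apply, map_add, map_sub, map_smul]
    rw [hu i]
    module
  have hpow : ∀ i ≤ n, ‖h i - (gradientOp S η ^ i) (h 0)‖ ≤
      i * (η ^ 2 * κ * (𝔇 * U + 𝔡) + η ^ 2 * 𝔇 * W) := by
    intro i
    induction i with
    | zero => simp
    | succ i ih =>
      intro hi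
      have e1 : h (i + 1) - (gradientOp S η ^ (i + 1)) (h 0) =
          gradientOp S η (h i - (gradientOp S η ^ i) (h 0)) +
          ((η ^ 2) • S.adjoint (S (D i (u i) - d i)) + η • D (i + 1) (u (i + 1) - u i)) := by
        rw [hstep, pow_succ' (gradientOp S η), mul_apply_eq_comp,
            map_sub (gradientOp S η)]
        abel
      rw [e1]
      have b1 := (norm_gradientOp_apply_le hη hS (h i - (gradientOp S η ^ i) (h 0))).trans
        (ih (by omega))
      have b2 : ‖(η ^ 2) • S.adjoint (S (D i (u i) - d i))‖ ≤ η ^ 2 * κ * (𝔇 * U + 𝔡) := by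
        rw [norm_smul, Real.norm_of_nonneg (sq_nonneg η), mul_assoc]
        gcongr
        exact (hT _).trans (by gcongr; exact hDd i (by omega))
      have b3 : ‖η • D (i + 1) (u (i + 1) - u i)‖ ≤ η ^ 2 * 𝔇 * W := by
        rw [norm_smul, Real.norm_of_nonneg hη]
        calc _ ≤ η * (𝔇 * (η * W)) := by
              gcongr
              exact (hD _ hi _).trans (by gcongr; exact hW i (by omega))
          _ = _ := by ring
      refine (norm_add_le _ _).trans ((add_le_add b1 ((norm_add_le _ _).trans
        (add_le_add b2 b3))).trans (le_of_eq ?_))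
      push_cast
      ring
  have h0 : h 0 = u 0 - v 0 := by simp [hh, hDdef, hddef]
  have e2 : u n - v n - (gradientOp S η ^ n) (u 0 - v 0) =
      (h n - (gradientOp S η ^ n) (h 0)) - η • (D n (u n) - d n) := by
    rw [h0]
    simp only [hh]
    abel
  rw [e2]
  refine (norm_sub_le _ _).trans ?_
  rw [add_comm]
  refine add_le_add ?_ (hpow n le_rfl)
  rw [norm_smul, Real.norm_of_nonneg hη]
  gcongr
  exact hDd n le_rfl

end Epoch

/-! ### Accumulated sample error over `t` epochs. -/

section SampleError

theorem sum_one_div_sqrt_le (t : ℕ) :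
    ∑ s ∈ Finset.range t, 1 / √((s : ℝ) + 1) ≤ 2 * √t := by
  induction t with
  | zero => simp
  | succ t ih =>
    rw [Finset.sum_range_succ]
    have h1 : 0 < √((t : ℝ) + 1) := by positivity
    have h2 : √(t : ℝ) ≤ √((t : ℝ) + 1) := Real.sqrt_le_sqrt (by linarith)
    have h3 : 1 / √((t : ℝ) + 1) ≤ 2 * (√((t : ℝ) + 1) - √t) := by
      rw [div_le_iff₀ h1]
      have e1 := Real.mul_self_sqrt (show (0 : ℝ) ≤ (t : ℝ) + 1 by positivity)
      have e2 := Real.mul_self_sqrt (show (0 : ℝ) ≤ (t : ℝ) by positivity)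
      nlinarith [sq_nonneg (√((t : ℝ) + 1) - √t)]
    push_cast
    linarith

/-- Bounding each numerator by `√t` and reversing the order of summation leaves `√t ∑ 1 / √(s + 1)`.
The numerators are the growth of the iterates, the denominators the smoothing by later epochs. -/
theorem sum_sqrt_div_sqrt_le (t : ℕ) :
    ∑ s ∈ Finset.range t, √((s : ℝ) + 1) / √((t : ℝ) - s) ≤ 2 * t := by
  calc _ ≤ ∑ s ∈ Finset.range t, √(t : ℝ) * (1 / √(((t - 1 - s : ℕ) : ℝ) + 1)) := by
        refine Finset.sum_le_sum fun s hs => ?_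
        have hs' : s + 1 ≤ t := Finset.mem_range.1 hs
        have h1 : (((t - 1 - s : ℕ) : ℝ) + 1) = t - s := by
          rw [show t - 1 - s = t - (s + 1) by omega, Nat.cast_sub hs']
          push_cast
          ring
        rw [h1, mul_one_div]
        gcongr
        exact_mod_cast hs'
    _ = √(t : ℝ) * ∑ s ∈ Finset.range t, 1 / √((s : ℝ) + 1) := by
        rw [← Finset.mul_sum, Finset.sum_range_reflect (fun s => 1 / √((s : ℝ) + 1))]
    _ ≤ √(t : ℝ) * (2 * √t) := by
        gcongr
        exact sum_one_div_sqrt_le t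
    _ = 2 * t := by
        rw [mul_left_comm, Real.mul_self_sqrt (Nat.cast_nonneg t)]

variable {H G : Type*} [NormedAddCommGroup H] [InnerProductSpace ℝ H] [CompleteSpace H]
  [NormedAddCommGroup G] [InnerProductSpace ℝ G] [CompleteSpace G]

/-- The distance between the incremental iterates and the gradient iterates of the population,
when the partial sums of the sampling errors are controlled. -/
theorem norm_iterate_sub_gradientSeq_le {S : H →L[ℝ] G} {γ κ M c : ℝ} (hγ : 0 < γ) (hκ : 0 < κ)
    (hM : 0 ≤ M) (hc : 0 ≤ c) (hγκ : γ * κ ≤ 1) (hS : ‖S‖ ^ 2 ≤ κ) {b : H} {n : ℕ} (hn : 1 ≤ n)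
    {z : Fin n → H × ℝ} (hx : ∀ i, ‖(z i).1‖ ^ 2 ≤ κ) (hy : ∀ i, |(z i).2| ≤ M)
    (hD : ∀ k (hk : k ≤ n) (w : H), ‖∑ j : Fin k, (⟪w, (z (Fin.castLE hk j)).1⟫ •
      (z (Fin.castLE hk j)).1 - S.adjoint (S w))‖ ≤ c * κ * √n * ‖w‖)
    (hd : ∀ k (hk : k ≤ n), ‖∑ j : Fin k, ((z (Fin.castLE hk j)).2 •
      (z (Fin.castLE hk j)).1 - b)‖ ≤ c * √κ * M * √n) (t : ℕ) :
    ‖S (iterate γ z 0 t - gradientSeq S (γ / n) b (n * t))‖ ≤ 12 * c * M * t / √n := by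
  have hn' : (1 : ℝ) ≤ n := by exact_mod_cast hn
  have hn0 : (0 : ℝ) < n := by linarith
  set η := γ / n with hηdef
  have hη : 0 ≤ η := by positivity
  have hηγ : η ≤ γ := div_le_self hγ.le hn'
  have hnη : n * η = γ := by
    rw [hηdef]
    field_simp
  have hγS : γ * ‖S‖ ^ 2 ≤ 1 := le_trans (by gcongr) hγκ
  have hηS : η * ‖S‖ ^ 2 ≤ 1 := le_trans (by gcongr) hγS
  have hT : ∀ w, ‖S.adjoint (S w)‖ ≤ κ * ‖w‖ := fun w => by
    calc _ ≤ ‖S.adjoint‖ * (‖S‖ * ‖w‖) := S.adjoint.le_opNorm_of_le (S.le_opNorm w)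
      _ = ‖S‖ ^ 2 * ‖w‖ := by
        rw [LinearIsometryEquiv.norm_map]
        ring
      _ ≤ _ := by gcongr
  -- Extension of the sample by zero; only indices below `n` enter the bounds.
  set zz : ℕ → H × ℝ := fun j => if h : j < n then z ⟨j, h⟩ else 0 with hzz
  have hzzf : ∀ i : Fin n, zz i = z i := fun i => by simp [hzz]
  have hzzk : ∀ k (hk : k ≤ n) (j : Fin k), zz j = z (Fin.castLE hk j) := fun k hk j =>
    hzzf (Fin.castLE hk j)
  have hzzx : ∀ i < n, ‖(zz i).1‖ ^ 2 ≤ κ := fun i hi => by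
    simpa [hzz, hi] using hx ⟨i, hi⟩
  have hzzy : ∀ i < n, |(zz i).2| ≤ M := fun i hi => by
    simpa [hzz, hi] using hy ⟨i, hi⟩
  have hepoch : ∀ w, epoch γ z w = incrementalSeq η zz w n := fun w => by
    rw [← foldl_eq_incrementalSeq]
    simp only [hzzf]
    rfl
  have hzzη : ∀ i < n, η * ‖(zz i).1‖ ^ 2 ≤ 1 := fun i hi =>
    le_trans (mul_le_mul hηγ (hzzx i hi) (by positivity) hγ.le) hγκ
  have hnorm : ∀ s, ‖iterate γ z 0 s‖ ^ 2 ≤ s * (γ * M ^ 2) := by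
    intro s
    induction s with
    | zero => simp [iterate]
    | succ s ih =>
      rw [iterate, hepoch]
      refine (norm_sq_incrementalSeq_le hη hzzη hzzy _ le_rfl).trans ?_
      rw [← mul_assoc, hnη]
      push_cast
      linarith
  have hU : ∀ s i, i ≤ n →
      ‖incrementalSeq η zz (iterate γ z 0 s) i‖ ≤ √γ * M * √((s : ℝ) + 1) := by
    intro s i hi
    refine (sq_le_sq₀ (norm_nonneg _) (by positivity)).1 ?_
    refine (norm_sq_incrementalSeq_le hη hzzη hzzy _ hi).trans ?_
    rw [mul_pow, mul_pow, Real.sq_sqrt hγ.le, Real.sq_sqrt (by positivity)]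
    have h1 : (i : ℝ) * (η * M ^ 2) ≤ n * (η * M ^ 2) := by gcongr
    rw [← mul_assoc (n : ℝ), hnη] at h1
    linarith [hnorm s]
  have hq : ∀ s, ‖(iterate γ z 0 (s + 1) - gradientSeq S η b (n * (s + 1))) -
      (gradientOp S η ^ n) (iterate γ z 0 s - gradientSeq S η b (n * s))‖ ≤
      6 * √γ * c * M / √n * √((s : ℝ) + 1) := by
    intro s
    set R := √((s : ℝ) + 1) with hR
    have hR1 : 1 ≤ R := Real.one_le_sqrt.2 (by linarith [(Nat.cast_nonneg s : (0 : ℝ) ≤ s)])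
    set g := √γ with hg
    set k := √κ with hk
    have hg0 : 0 ≤ g := Real.sqrt_nonneg _
    have hk0 : 0 ≤ k := Real.sqrt_nonneg _
    have hgg : g ^ 2 = γ := Real.sq_sqrt hγ.le
    have hkk : k ^ 2 = κ := Real.sq_sqrt hκ.le
    have hgk : g * k ≤ 1 := by
      rw [hg, hk, ← Real.sqrt_mul hγ.le]
      exact Real.sqrt_le_one.2 hγκ
    have key := norm_epoch_error_le (S := S) (η := η) (κ := κ) (𝔇 := c * κ * √n)
      (𝔡 := c * k * M * √n) (U := g * M * R) (W := κ * (g * M * R) + k * M) hη hκ.le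
      (by positivity) hηS hT (b := b) (z := zz) (n := n)
      (fun k hk w => by
        rw [Finset.sum_range]
        simpa only [hzzk k hk] using hD k hk w)
      (fun k hk => by
        rw [Finset.sum_range]
        simpa only [hzzk k hk] using hd k hk)
      (u := incrementalSeq η zz (iterate γ z 0 s))
      (v := fun i => gradientSeq S η b (n * s + i)) (fun i => rfl) (fun i => rfl)
      (hU s) (fun i hi => by
        refine (norm_step_sub_le hη (hzzx i hi) (hzzy i hi) _).trans ?_
        gcongr
        exact hU s i hi.le)
    rw [← hepoch] at key
    refine key.trans ?_
    rw [show (n : ℝ) * (η ^ 2 * κ * (c * κ * √n * (g * M * R) + c * k * M * √n) +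
        η ^ 2 * (c * κ * √n) * (κ * (g * M * R) + k * M)) =
        η * (n * η) * (κ * (c * κ * √n * (g * M * R) + c * k * M * √n) +
        (c * κ * √n) * (κ * (g * M * R) + k * M)) by ring, hnη]
    have hηn : η * √n = γ / √n := by
      rw [hηdef]
      have : √(n : ℝ) ≠ 0 := by positivity
      field_simp
      rw [Real.sq_sqrt hn0.le]
    -- Everything depends on `g k = √(γ κ) ≤ 1`, so the bracket is at most `3 R + 3 ≤ 6 R`, because
    -- `R ≥ 1`.
    have e1 : η * (c * κ * √n * (g * M * R) + c * k * M * √n) +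
        η * γ * (κ * (c * κ * √n * (g * M * R) + c * k * M * √n) +
        c * κ * √n * (κ * (g * M * R) + k * M)) =
        g * c * M / √n * ((g * k) ^ 2 * R + g * k +
          2 * (g * k) ^ 4 * R + 2 * (g * k) ^ 3) := by
      rw [← hgg, ← hkk] at *
      linear_combination (c * k ^ 2 * (g * M * R) + c * k * M +
        g ^ 2 * (k ^ 2 * (c * k ^ 2 * (g * M * R) + c * k * M) +
        c * k ^ 2 * (k ^ 2 * (g * M * R) + k * M))) * hηn
    rw [e1, show 6 * g * c * M / √n * R = g * c * M / √n * (6 * R) by ring]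
    gcongr
    have hgk0 : 0 ≤ g * k := by positivity
    have p2 : (g * k) ^ 2 ≤ 1 := pow_le_one₀ hgk0 hgk
    have p3 : (g * k) ^ 3 ≤ 1 := pow_le_one₀ hgk0 hgk
    have p4 : (g * k) ^ 4 ≤ 1 := pow_le_one₀ hgk0 hgk
    nlinarith
  have main := norm_apply_le_sum_of_perturbation hγ hγS hn
    (e := fun s => iterate γ z 0 s - gradientSeq S η b (n * s)) (by simp [iterate, gradientSeq])
    hq t 0
  simp only [mul_zero, pow_zero, one_apply_eq_self, Nat.cast_zero, add_zero] at main
  refine main.trans ?_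
  calc _ = 6 * c * M / √n * ∑ s ∈ Finset.range t, √((s : ℝ) + 1) / √((t : ℝ) - s) := by
        rw [Finset.mul_sum]
        refine Finset.sum_congr rfl fun s hs => ?_
        rw [Real.sqrt_mul hγ.le]
        have : √γ ≠ 0 := by positivity
        field_simp
    _ ≤ 6 * c * M / √n * (2 * t) := by
        gcongr
        exact sum_sqrt_div_sqrt_le t
    _ = _ := by ring

end SampleError

/-! ### Bias of population gradient descent under the source condition. -/

section Bias

/-- From `1 - η σ ≤ exp (-η σ)` the left side is at most `(σ exp (-x)) ^ r` with `x = η N σ / r`,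
and `x exp (-x) ≤ 1`. -/
theorem rpow_mul_one_sub_pow_le {r η : ℝ} (hr : 0 < r) (hη : 0 < η) {N : ℕ} (hN : 1 ≤ N) {σ : ℝ}
    (hσ : 0 ≤ σ) (hσ' : η * σ ≤ 1) : σ ^ r * (1 - η * σ) ^ N ≤ (r / (η * N)) ^ r := by
  have hN' : (0 : ℝ) < N := by exact_mod_cast hN
  have h1 : (1 - η * σ) ^ N ≤ Real.exp (-(η * N * σ / r)) ^ r := by
    rw [← Real.exp_mul]
    calc (1 - η * σ) ^ N ≤ Real.exp (-(η * σ)) ^ N := by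
          refine pow_le_pow_left₀ (by linarith) ?_ N
          linarith [Real.add_one_le_exp (-(η * σ))]
      _ = _ := by
          rw [← Real.exp_nat_mul]
          congr 1
          field_simp
  calc _ ≤ σ ^ r * Real.exp (-(η * N * σ / r)) ^ r := by gcongr
    _ = (σ * Real.exp (-(η * N * σ / r))) ^ r :=
        (Real.mul_rpow hσ (Real.exp_pos _).le).symm
    _ ≤ _ := by
        gcongr
        rw [Real.exp_neg, mul_inv_le_iff₀ (Real.exp_pos _), div_mul_eq_mul_div,
          le_div_iff₀ (by positivity)]
        have h2 := Real.add_one_le_exp (η * N * σ / r)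
        have h3 : r * (η * N * σ / r) = σ * (η * N) := by field_simp
        nlinarith

variable {G : Type*} [NormedAddCommGroup G] [InnerProductSpace ℝ G]

theorem norm_sum_smul_sq_eq {ι : Type*} {p : ι → G} (hp : ∀ i j, i ≠ j → ⟪p i, p j⟫ = 0)
    (s : Finset ι) (a : ι → ℝ) : ‖∑ i ∈ s, a i • p i‖ ^ 2 = ∑ i ∈ s, a i ^ 2 * ‖p i‖ ^ 2 := by
  rw [← real_inner_self_eq_norm_sq, sum_inner]
  refine Finset.sum_congr rfl fun i hi => ?_
  rw [inner_sum, Finset.sum_eq_single_of_mem i hi]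
  · rw [real_inner_smul_left, real_inner_smul_right, real_inner_self_eq_norm_sq]
    ring
  · intro j _ hj
    rw [real_inner_smul_left, real_inner_smul_right, hp i j hj.symm]
    ring

/-- Bessel's inequality for the components of a vector along mutually orthogonal directions. -/
theorem sum_norm_sq_le {ι : Type*} {p : ι → G} (hp : ∀ i j, i ≠ j → ⟪p i, p j⟫ = 0) {g : G}
    (hg : ∀ i, ⟪p i, g⟫ = ‖p i‖ ^ 2) (s : Finset ι) : ∑ i ∈ s, ‖p i‖ ^ 2 ≤ ‖g‖ ^ 2 := by
  have h1 := norm_sum_smul_sq_eq hp s (fun _ => 1)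
  simp only [one_smul, one_pow, one_mul] at h1
  have h2 : ⟪∑ i ∈ s, p i, g⟫ = ‖∑ i ∈ s, p i‖ ^ 2 := by
    rw [sum_inner, h1]
    exact Finset.sum_congr rfl fun i _ => hg i
  have h3 := real_inner_le_norm (∑ i ∈ s, p i) g
  rw [h2] at h3
  rw [← h1]
  nlinarith [norm_nonneg (∑ i ∈ s, p i), norm_nonneg g, sq_nonneg (‖∑ i ∈ s, p i‖ - ‖g‖)]

variable {H : Type*} [NormedAddCommGroup H] [InnerProductSpace ℝ H] [CompleteSpace H]
  [CompleteSpace G]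

/-- The bias bound: decay of `(1 - η SS†) ^ N` on the range of `(SS†) ^ r`. -/
theorem norm_pow_fractionalPower_le {S : H →L[ℝ] G} {η r : ℝ} (hη : 0 < η)
    (hS : η * ‖S‖ ^ 2 ≤ 1) (hr : 0 < r) {N : ℕ} (hN : 1 ≤ N) (g : G) :
    ‖((ContinuousLinearMap.id ℝ G - η • (S ∘L S.adjoint)) ^ N)
      (fractionalPower (S ∘L S.adjoint) r g)‖ ≤ (r / (η * N)) ^ r * ‖g‖ := by
  set L := S ∘L S.adjoint with hL
  set B := ContinuousLinearMap.id ℝ G - η • L with hB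
  set p : ℝ → G := fun σ =>
    (L - σ • ContinuousLinearMap.id ℝ G).ker.starProjection g with hp
  have hC : 0 ≤ (r / (η * N)) ^ r := by positivity
  have hpK : ∀ σ, L (p σ) = σ • p σ := by
    intro σ
    have h2 : (L - σ • ContinuousLinearMap.id ℝ G) (p σ) = 0 :=
      Submodule.starProjection_apply_mem (L - σ • ContinuousLinearMap.id ℝ G).ker g
    simpa [sub_eq_zero] using h2
  have hsymm : ∀ a b : G, ⟪L a, b⟫ = ⟪a, L b⟫ := by
    intro a b
    simp only [hL, ContinuousLinearMap.comp_apply]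
    rw [← ContinuousLinearMap.adjoint_inner_left, ContinuousLinearMap.adjoint_inner_right]
  have horth : ∀ σ τ, σ ≠ τ → ⟪p σ, p τ⟫ = 0 := by
    intro σ τ hστ
    have h1 := hsymm (p σ) (p τ)
    rw [hpK, hpK, real_inner_smul_left, real_inner_smul_right] at h1
    have h2 : (σ - τ) * ⟪p σ, p τ⟫ = 0 := by linarith
    exact (mul_eq_zero.1 h2).resolve_left (sub_ne_zero.2 hστ)
  have hself : ∀ σ, ⟪p σ, g⟫ = ‖p σ‖ ^ 2 := by
    intro σ
    have h1 : ⟪g - p σ, p σ⟫ = 0 :=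
      Submodule.starProjection_inner_eq_zero g (p σ) (Submodule.starProjection_apply_mem _ _)
    rw [inner_sub_left, real_inner_self_eq_norm_sq] at h1
    rw [real_inner_comm]
    linarith
  -- If the series did not converge, `tsum` would be `0` and the bound trivial; compactness of the
  -- operator is therefore not needed.
  by_cases hsum : Summable fun σ : ℝ => σ ^ r • p σ
  swap
  · rw [fractionalPower, tsum_eq_zero_of_not_summable hsum]
    simpa using mul_nonneg hC (norm_nonneg g)
  have hBp : ∀ σ (m : ℕ), (B ^ m) (p σ) = (1 - η * σ) ^ m • p σ := by
    intro σ m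
    induction m with
    | zero => simp
    | succ m ih =>
      rw [pow_succ' B, mul_apply_eq_comp, ih, map_smul]
      have : B (p σ) = (1 - η * σ) • p σ := by
        simp only [hB, sub_apply, smul_apply, ContinuousLinearMap.id_apply, hpK]
        module
      rw [this, smul_smul, pow_succ]
  have hhas := (B ^ N).hasSum hsum.hasSum
  have hbd : ∀ σ, (σ ^ r * (1 - η * σ) ^ N) ^ 2 * ‖p σ‖ ^ 2 ≤
      ((r / (η * N)) ^ r) ^ 2 * ‖p σ‖ ^ 2 := by
    intro σ
    -- Only eigenvalues with `p σ ≠ 0` matter. For them positivity of `S S†` and `η ‖S‖² ≤ 1` give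
    -- `0 ≤ σ ≤ 1 / η`.
    by_cases hpσ : p σ = 0
    · simp [hpσ]
    have hpos : 0 < ‖p σ‖ ^ 2 := by positivity
    have h1 : σ * ‖p σ‖ ^ 2 = ‖S.adjoint (p σ)‖ ^ 2 := by
      rw [← real_inner_self_eq_norm_sq, ← real_inner_smul_left, ← hpK,
        ← real_inner_self_eq_norm_sq (S.adjoint (p σ)), ContinuousLinearMap.adjoint_inner_right]
      rfl
    have hσ : 0 ≤ σ := by
      by_contra hcon
      nlinarith [sq_nonneg ‖S.adjoint (p σ)‖]
    have hσ' : η * σ ≤ 1 := by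
      have h2 := mul_norm_sq_apply_le (S := S.adjoint) hη.le
        (by rwa [LinearIsometryEquiv.norm_map]) (p σ)
      rw [← h1, ← mul_assoc] at h2
      exact le_of_mul_le_mul_right (by linarith) hpos
    have h0 : 0 ≤ σ ^ r * (1 - η * σ) ^ N :=
      mul_nonneg (Real.rpow_nonneg hσ r) (pow_nonneg (by linarith) N)
    have h3 := rpow_mul_one_sub_pow_le hr hη hN hσ hσ'
    gcongr
  refine le_of_tendsto' hhas.norm fun s => ?_
  refine (sq_le_sq₀ (norm_nonneg _) (by positivity)).1 ?_
  simp only [map_smul, hBp, smul_smul]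
  rw [norm_sum_smul_sq_eq horth, mul_pow]
  refine (Finset.sum_le_sum fun σ _ => hbd σ).trans ?_
  rw [← Finset.mul_sum]
  gcongr
  exact sum_norm_sq_le horth hself s

/-- The residual of the gradient iterates started at `0`. -/
theorem apply_gradientSeq_sub (S : H →L[ℝ] G) (η : ℝ) (h : G) (m : ℕ) :
    S (gradientSeq S η (S.adjoint h) m) - h =
      -((ContinuousLinearMap.id ℝ G - η • (S ∘L S.adjoint)) ^ m) h := by
  induction m with
  | zero => simp [gradientSeq]
  | succ m ih =>
    rw [pow_succ' (ContinuousLinearMap.id ℝ G - η • (S ∘L S.adjoint)), mul_apply_eq_comp,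
      ← map_neg, ← ih, gradientSeq, gradientOp_apply]
    simp only [sub_apply, smul_apply, ContinuousLinearMap.id_apply,
      ContinuousLinearMap.comp_apply, map_sub, map_add, map_smul]
    module

end Bias

/-! ### The regression function as an element of `L²`. -/

section Marginal

theorem Lp_norm_sq_eq_integral {X : Type*} [MeasurableSpace X] {μ : Measure X} (u : Lp ℝ 2 μ) : ‖u‖ ^ 2 = ∫ x, u x ^ 2 ∂μ := by
  rw [← real_inner_self_eq_norm_sq, L2.inner_def]
  simp [sq]

variable {X : Type*} [MeasurableSpace X] {ρ : Measure (X × ℝ)} [IsProbabilityMeasure ρ] {M : ℝ}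

theorem memLp_regressionFunction (hy : ∀ᵐ z ∂ρ, |z.2| ≤ M) :
    MemLp (regressionFunction ρ) 2 ρ.fst := by
  refine MemLp.of_bound ?_ M ?_
  · exact (measurable_snd.aestronglyMeasurable (μ := ρ)).integral_condKernel
  · have h1 : ∀ᵐ z ∂(ρ.fst ⊗ₘ ρ.condKernel), |z.2| ≤ M := by
      rwa [ρ.disintegrate ρ.condKernel]
    filter_upwards [Measure.ae_ae_of_ae_compProd h1] with x hx
    refine (norm_integral_le_of_norm_le_const hx).trans ?_
    simp

theorem integral_mul_snd {φ : X → ℝ} (hφ : Integrable (fun z : X × ℝ => φ z.1 * z.2) ρ) :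
    ∫ z, φ z.1 * z.2 ∂ρ = ∫ x, φ x * regressionFunction ρ x ∂ρ.fst := by
  rw [← Measure.integral_condKernel hφ]
  refine integral_congr_ae (Filter.Eventually.of_forall fun x => ?_)
  exact MeasureTheory.integral_const_mul (φ x) fun y : ℝ => y

theorem memLp_comp_fst {ρ : Measure (X × ℝ)} {E : Type*} [NormedAddCommGroup E] {φ : X → E} (hφ : MemLp φ 2 ρ.fst) :
    MemLp (fun z : X × ℝ => φ z.1) 2 ρ :=
  hφ.comp_measurePreserving ⟨measurable_fst, rfl⟩

theorem memLp_snd (hy : ∀ᵐ z ∂ρ, |z.2| ≤ M) : MemLp (fun z : X × ℝ => z.2) 2 ρ :=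
  MemLp.of_bound measurable_snd.aestronglyMeasurable M hy

theorem eLpNorm_regressionFunction_sub (hy : ∀ᵐ z ∂ρ, |z.2| ≤ M) (h : Lp ℝ 2 ρ.fst) :
    eLpNorm (fun x => regressionFunction ρ x - h x) 2 ρ.fst =
      ‖(memLp_regressionFunction hy).toLp - h‖ₑ := by
  rw [Lp.enorm_def]
  refine eLpNorm_congr_ae ?_
  filter_upwards [Lp.coeFn_sub (memLp_regressionFunction hy).toLp h,
    (memLp_regressionFunction hy).coeFn_toLp] with x h1 h2
  rw [h1, Pi.sub_apply, h2]

end Marginal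

/-! ### The operator `S` and the factorization `L = S S†`. -/

section LinearFunctions

variable {H : Type*} [NormedAddCommGroup H] [InnerProductSpace ℝ H] [MeasurableSpace H]

/-- The operator `w ↦ ⟪w, ·⟫` from `H` to `L²(H, μ)`. -/
noncomputable def linearOp {μ : Measure H} (hμ : MemLp (fun x : H => x) 2 μ) :
    H →L[ℝ] Lp ℝ 2 μ :=
  LinearMap.mkContinuous
    { toFun := fun w => (hμ.const_inner w).toLp
      map_add' := fun v w => by
        rw [← MemLp.toLp_add]
        exact MemLp.toLp_congr _ _ (Filter.Eventually.of_forall fun x => inner_add_left _ _ _)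
      map_smul' := fun c w => by
        rw [RingHom.id_apply, ← MemLp.toLp_const_smul]
        exact MemLp.toLp_congr _ _
          (Filter.Eventually.of_forall fun x => real_inner_smul_left _ _ _) }
    ‖hμ.toLp‖ fun w => by
      rw [mul_comm]
      refine Lp.norm_le_mul_norm_of_ae_le_mul ?_
      filter_upwards [(hμ.const_inner (𝕜 := ℝ) w).coeFn_toLp, hμ.coeFn_toLp] with x h1 h2
      rw [LinearMap.coe_mk, AddHom.coe_mk, h1, h2]
      exact norm_inner_le_norm _ _

theorem linearOp_ae_eq {μ : Measure H} (hμ : MemLp (fun x : H => x) 2 μ) (w : H) :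
    linearOp hμ w =ᵐ[μ] fun x => ⟪w, x⟫ :=
  (hμ.const_inner w).coeFn_toLp

theorem norm_linearOp_sq_le {μ : Measure H} [IsProbabilityMeasure μ]
    (hμ : MemLp (fun x : H => x) 2 μ) {κ : ℝ} (hκ : 0 ≤ κ) (hx : ∀ᵐ x ∂μ, ‖x‖ ^ 2 ≤ κ) :
    ‖linearOp hμ‖ ^ 2 ≤ κ := by
  rw [← Real.sq_sqrt hκ]
  gcongr
  refine ContinuousLinearMap.opNorm_le_bound _ (Real.sqrt_nonneg κ) fun w => ?_
  have h1 := Lp.norm_le_of_ae_bound (f := linearOp hμ w) (C := √κ * ‖w‖) (by positivity) (by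
    filter_upwards [linearOp_ae_eq hμ w, hx] with x h1 h2
    rw [h1, mul_comm]
    refine (norm_inner_le_norm _ _).trans ?_
    gcongr
    exact Real.le_sqrt_of_sq_le h2)
  simpa [measureUnivNNReal] using h1

theorem range_linearOp {μ : Measure H} (hμ : MemLp (fun x : H => x) 2 μ) :
    linearFunctions μ = ((linearOp hμ).range : Set (Lp ℝ 2 μ)) := by
  ext f
  constructor
  · rintro ⟨w, hw⟩
    exact ⟨w, Lp.ext ((linearOp_ae_eq hμ w).trans hw.symm)⟩
  · rintro ⟨w, rfl⟩
    exact ⟨w, linearOp_ae_eq hμ w⟩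

variable [CompleteSpace H]

theorem linearOp_adjoint_apply {μ : Measure H} (hμ : MemLp (fun x : H => x) 2 μ)
    (f : Lp ℝ 2 μ) : (linearOp hμ).adjoint f = ∫ x, f x • x ∂μ := by
  refine ext_inner_left ℝ fun w => ?_
  rw [ContinuousLinearMap.adjoint_inner_right, L2.inner_def,
    ← integral_inner (integrable_smul_self hμ f)]
  refine integral_congr_ae ?_
  filter_upwards [linearOp_ae_eq hμ w] with x hx
  rw [hx, real_inner_smul_right]
  simp

theorem integralOperator_eq {μ : Measure H} (hμ : MemLp (fun x : H => x) 2 μ) :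
    integralOperator μ = linearOp hμ ∘L (linearOp hμ).adjoint := by
  refine ContinuousLinearMap.ext fun f => Lp.ext ?_
  filter_upwards [integralOperator_ae_eq hμ f,
    linearOp_ae_eq hμ ((linearOp hμ).adjoint f)] with x h1 h2
  rw [h1, ContinuousLinearMap.comp_apply, h2, integral_kernel_eq hμ f, linearOp_adjoint_apply,
    real_inner_comm]

end LinearFunctions

/-! ### Excess risk as an `L²` distance. -/

section Regression

variable {H : Type*} [NormedAddCommGroup H] [InnerProductSpace ℝ H] [MeasurableSpace H]
  {ρ : Measure (H × ℝ)} [IsProbabilityMeasure ρ] {M : ℝ}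

theorem integrable_inner_mul_snd (hμ : MemLp (fun x : H => x) 2 ρ.fst)
    (hy : ∀ᵐ z ∂ρ, |z.2| ≤ M) (w : H) :
    Integrable (fun z : H × ℝ => ⟪w, z.1⟫ * z.2) ρ :=
  (memLp_comp_fst (hμ.const_inner w)).integrable_mul (memLp_snd hy)

theorem inner_linearOp_regressionFunction (hμ : MemLp (fun x : H => x) 2 ρ.fst)
    (hy : ∀ᵐ z ∂ρ, |z.2| ≤ M) (w : H) :
    ⟪linearOp hμ w, (memLp_regressionFunction hy).toLp⟫ = ∫ z, ⟪w, z.1⟫ * z.2 ∂ρ := by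
  rw [integral_mul_snd (integrable_inner_mul_snd hμ hy w), L2.inner_def]
  refine integral_congr_ae ?_
  filter_upwards [linearOp_ae_eq hμ w, (memLp_regressionFunction hy).coeFn_toLp] with x h1 h2
  rw [h1, h2]
  simp [mul_comm]

/-- The risk is the squared `L²` distance to the regression function, up to a constant. -/
theorem risk_eq (hμ : MemLp (fun x : H => x) 2 ρ.fst) (hy : ∀ᵐ z ∂ρ, |z.2| ≤ M) (w : H) :
    risk ρ w = ‖linearOp hμ w - (memLp_regressionFunction hy).toLp‖ ^ 2 +
      (∫ z, z.2 ^ 2 ∂ρ - ‖(memLp_regressionFunction hy).toLp‖ ^ 2) := by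
  have h1 : ‖linearOp hμ w‖ ^ 2 = ∫ z, ⟪w, z.1⟫ ^ 2 ∂ρ := by
    rw [Lp_norm_sq_eq_integral]
    have h2 : ∫ z, ⟪w, z.1⟫ ^ 2 ∂ρ = ∫ x, ⟪w, x⟫ ^ 2 ∂ρ.fst := by
      rw [Measure.fst, integral_map measurable_fst.aemeasurable]
      exact ((hμ.const_inner w).integrable_sq (μ := ρ.fst)).1
    rw [h2]
    refine integral_congr_ae ?_
    filter_upwards [linearOp_ae_eq hμ w] with x hx
    rw [hx]
  have i1 := (memLp_comp_fst (hμ.const_inner w)).integrable_sq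
  have i2 := (memLp_snd hy).integrable_sq
  have i3 := integrable_inner_mul_snd hμ hy w
  rw [norm_sub_sq_real, h1, inner_linearOp_regressionFunction hμ hy w, risk]
  have h3 : ∫ z, (⟪w, z.1⟫ - z.2) ^ 2 ∂ρ =
      ∫ z, (⟪w, z.1⟫ ^ 2 - 2 * (⟪w, z.1⟫ * z.2)) + z.2 ^ 2 ∂ρ := by
    congr 1
    ext z
    ring
  have i4 : Integrable (fun z : H × ℝ => ⟪w, z.1⟫ ^ 2 - 2 * (⟪w, z.1⟫ * z.2)) ρ :=
    i1.sub (i3.const_mul 2)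
  rw [h3, integral_add i4 i2, integral_sub i1 (i3.const_mul 2), integral_const_mul]
  ring

/-- The best linear approximation is the orthogonal projection of the regression function. -/
theorem IsBestLinearApprox.inner_sub_eq_zero (hμ : MemLp (fun x : H => x) 2 ρ.fst)
    (hy : ∀ᵐ z ∂ρ, |z.2| ≤ M) {h : Lp ℝ 2 ρ.fst} (hh : IsBestLinearApprox ρ h)
    {v : Lp ℝ 2 ρ.fst} (hv : v ∈ (linearOp hμ).range.topologicalClosure) :
    ⟪(memLp_regressionFunction hy).toLp - h, v⟫ = 0 := by
  set K := (linearOp hμ).range.topologicalClosure with hK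
  have hcl : closure (linearFunctions ρ.fst) = (K : Set (Lp ℝ 2 ρ.fst)) := by
    rw [range_linearOp hμ]
    rfl
  have hmem : h ∈ K := by
    have := hh.1
    rwa [hcl] at this
  refine (K.norm_eq_iInf_iff_real_inner_eq_zero hmem).1 (le_antisymm ?_ ?_) v hv
  · refine le_ciInf fun w => ?_
    have h1 := hh.2 w (by rw [hcl]; exact w.2)
    rw [eLpNorm_regressionFunction_sub hy, eLpNorm_regressionFunction_sub hy] at h1
    exact enorm_le_iff_norm_le.1 h1
  · exact ciInf_le (f := fun w : (K : Set (Lp ℝ 2 ρ.fst)) =>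
      ‖(memLp_regressionFunction hy).toLp - (w : Lp ℝ 2 ρ.fst)‖)
      ⟨0, by rintro _ ⟨w, rfl⟩; exact norm_nonneg _⟩ ⟨h, hmem⟩

/-- By Pythagoras the risk of every `w` is `‖S w - h‖²` plus a constant independent of `w`, and that
constant bounds the infimum from below. -/
theorem IsBestLinearApprox.risk_sub_iInf_le (hμ : MemLp (fun x : H => x) 2 ρ.fst)
    (hy : ∀ᵐ z ∂ρ, |z.2| ≤ M) {h : Lp ℝ 2 ρ.fst} (hh : IsBestLinearApprox ρ h) (w : H) :
    risk ρ w - ⨅ w : H, risk ρ w ≤ ‖linearOp hμ w - h‖ ^ 2 := by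
  have hmem : h ∈ (linearOp hμ).range.topologicalClosure := by
    have := hh.1
    rwa [range_linearOp hμ] at this
  set f := (memLp_regressionFunction hy).toLp with hf
  have hpyth : ∀ w, ‖linearOp hμ w - f‖ ^ 2 = ‖linearOp hμ w - h‖ ^ 2 + ‖f - h‖ ^ 2 := by
    intro w
    have hw : linearOp hμ w - h ∈ (linearOp hμ).range.topologicalClosure :=
      sub_mem (Submodule.le_topologicalClosure _ ⟨w, rfl⟩) hmem
    have h1 := hh.inner_sub_eq_zero hμ hy hw
    rw [← sub_sub_sub_cancel_right _ _ h, norm_sub_sq_real, real_inner_comm, h1]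
    ring
  have hinf : ‖f - h‖ ^ 2 + (∫ z, z.2 ^ 2 ∂ρ - ‖f‖ ^ 2) ≤ ⨅ w : H, risk ρ w := by
    refine le_ciInf fun w => ?_
    rw [risk_eq hμ hy w, hpyth]
    linarith [sq_nonneg ‖linearOp hμ w - h‖]
  rw [risk_eq hμ hy w, hpyth]
  linarith

variable [CompleteSpace H]

/-- Since `f_ρ - h` is orthogonal to the range of `S`, `S† h = S† f_ρ`, the mean of `y x`. So the
samples `y_i x_i` are centred at the vector `b` that drives the population iteration. -/
theorem IsBestLinearApprox.inner_adjoint (hμ : MemLp (fun x : H => x) 2 ρ.fst)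
    (hy : ∀ᵐ z ∂ρ, |z.2| ≤ M) {h : Lp ℝ 2 ρ.fst} (hh : IsBestLinearApprox ρ h) (w : H) :
    ⟪w, (linearOp hμ).adjoint h⟫ = ∫ z, ⟪w, z.1⟫ * z.2 ∂ρ := by
  rw [← inner_linearOp_regressionFunction hμ hy w, ContinuousLinearMap.adjoint_inner_right]
  have h1 := hh.inner_sub_eq_zero hμ hy
    (Submodule.le_topologicalClosure _ (LinearMap.mem_range_self _ w))
  change ⟪_, linearOp hμ w⟫ = 0 at h1
  rw [inner_sub_left, real_inner_comm, real_inner_comm (linearOp hμ w) h] at h1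
  linarith

theorem inner_adjoint_linearOp {ρ : Measure (H × ℝ)} (hμ : MemLp (fun x : H => x) 2 ρ.fst) (v w : H) :
    ⟪v, (linearOp hμ).adjoint (linearOp hμ w)⟫ = ∫ z, ⟪v, z.1⟫ * ⟪w, z.1⟫ ∂ρ := by
  rw [ContinuousLinearMap.adjoint_inner_right, L2.inner_def]
  have h2 : ∫ z, ⟪v, z.1⟫ * ⟪w, z.1⟫ ∂ρ = ∫ x, ⟪v, x⟫ * ⟪w, x⟫ ∂ρ.fst := by
    rw [Measure.fst, integral_map measurable_fst.aemeasurable]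
    exact ((hμ.const_inner v).integrable_mul (hμ.const_inner w) (μ := ρ.fst)).1
  rw [h2]
  refine integral_congr_ae ?_
  filter_upwards [linearOp_ae_eq hμ v, linearOp_ae_eq hμ w] with x h1 h2
  rw [h1, h2]
  simp [mul_comm]

end Regression

/-! ### Concentration of the sample moments, and the high-probability event. -/

section Sampling

theorem memLp_id_of_ae_norm_sq_le {H : Type*} [NormedAddCommGroup H] [SecondCountableTopology H]
    [MeasurableSpace H] [BorelSpace H] {ρ : Measure (H × ℝ)} [IsProbabilityMeasure ρ] {κ : ℝ}
    (hx : ∀ᵐ x ∂ρ.fst, ‖x‖ ^ 2 ≤ κ) :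
    MemLp (fun x : H => x) 2 ρ.fst :=
  MemLp.of_bound stronglyMeasurable_id.aestronglyMeasurable (√κ)
    (hx.mono fun _ h => Real.le_sqrt_of_sq_le h)

theorem ae_norm_fst_sq_le {H : Type*} [NormedAddCommGroup H] [MeasurableSpace H]
    {ρ : Measure (H × ℝ)} {κ : ℝ} (hx : ∀ᵐ x ∂ρ.fst, ‖x‖ ^ 2 ≤ κ) :
    ∀ᵐ z ∂ρ, ‖z.1‖ ^ 2 ≤ κ :=
  ae_of_ae_map measurable_fst.aemeasurable hx

open scoped TensorProduct

variable {H : Type*} [NormedAddCommGroup H] [InnerProductSpace ℝ H]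

/-- The rank-one operator `⟪·, x⟫ x`, as an element of the Hilbert tensor square of `H`. -/
noncomputable def tensorSquare (x : H) : UniformSpace.Completion (H ⊗[ℝ] H) :=
  ((x ⊗ₜ[ℝ] x : H ⊗[ℝ] H) : UniformSpace.Completion (H ⊗[ℝ] H))

theorem continuous_tensorSquare : Continuous (tensorSquare : H → _) := by
  refine (UniformSpace.Completion.continuous_coe _).comp ?_
  exact TensorProduct.continuous_tmul.comp (continuous_id.prodMk continuous_id)

theorem norm_tensorSquare (x : H) : ‖tensorSquare x‖ = ‖x‖ ^ 2 := by
  rw [tensorSquare, UniformSpace.Completion.norm_coe, TensorProduct.norm_tmul, sq]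

theorem inner_tmul_tensorSquare (v w x : H) :
    ⟪((v ⊗ₜ[ℝ] w : H ⊗[ℝ] H) : UniformSpace.Completion (H ⊗[ℝ] H)), tensorSquare x⟫ =
      ⟪v, x⟫ * ⟪w, x⟫ := by
  rw [tensorSquare, UniformSpace.Completion.inner_coe, TensorProduct.inner_tmul]

variable [SecondCountableTopology H] [MeasurableSpace H] [BorelSpace H]
  {ρ : Measure (H × ℝ)} [IsProbabilityMeasure ρ] {M κ : ℝ}

theorem stronglyMeasurable_tensorSquare_fst :
    StronglyMeasurable fun z : H × ℝ => tensorSquare z.1 :=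
  continuous_tensorSquare.stronglyMeasurable.comp_measurable measurable_fst

theorem integrable_tensorSquare_fst (hx : ∀ᵐ x ∂ρ.fst, ‖x‖ ^ 2 ≤ κ) :
    Integrable (fun z : H × ℝ => tensorSquare z.1) ρ :=
  Integrable.of_bound stronglyMeasurable_tensorSquare_fst.aestronglyMeasurable κ (by
    simpa only [norm_tensorSquare] using ae_norm_fst_sq_le hx)

variable [CompleteSpace H]

/-- The Hilbert–Schmidt norm dominates the operator norm: `‖a‖² = ⟪a ⊗ w, D⟫ ≤ ‖a‖ ‖w‖ ‖D‖`. This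
gives uniformity in `w` from concentration of one vector of a Hilbert space. -/
theorem norm_sum_rankOne_sub_le (hx : ∀ᵐ x ∂ρ.fst, ‖x‖ ^ 2 ≤ κ)
    (hμ : MemLp (fun x : H => x) 2 ρ.fst) {k : ℕ} (z : Fin k → H × ℝ) (w : H) :
    ‖∑ j, (⟪w, (z j).1⟫ • (z j).1 - (linearOp hμ).adjoint (linearOp hμ w))‖ ≤
      ‖∑ j, (tensorSquare (z j).1 - ∫ z, tensorSquare z.1 ∂ρ)‖ * ‖w‖ := by
  set a := ∑ j, (⟪w, (z j).1⟫ • (z j).1 - (linearOp hμ).adjoint (linearOp hμ w)) with ha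
  set D := ∑ j, (tensorSquare (z j).1 - ∫ z, tensorSquare z.1 ∂ρ) with hD
  have hinner : ∀ v, ⟪v, a⟫ =
      ⟪((v ⊗ₜ[ℝ] w : H ⊗[ℝ] H) : UniformSpace.Completion (H ⊗[ℝ] H)), D⟫ := by
    intro v
    rw [ha, hD, inner_sum, inner_sum]
    refine Finset.sum_congr rfl fun j _ => ?_
    rw [inner_sub_right, inner_sub_right, inner_tmul_tensorSquare, real_inner_smul_right,
      inner_adjoint_linearOp, ← integral_inner (integrable_tensorSquare_fst hx)]
    simp only [inner_tmul_tensorSquare]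
    ring
  have h1 := (hinner a).trans_le (real_inner_le_norm _ _)
  rw [real_inner_self_eq_norm_sq, UniformSpace.Completion.norm_coe,
    TensorProduct.norm_tmul] at h1
  rcases (norm_nonneg a).eq_or_lt' with h0 | h0
  · rw [h0]
    positivity
  · refine le_of_mul_le_mul_left ?_ h0
    linarith

/-- Uniform concentration of the partial sums of the sample second moment operators. -/
theorem measure_exists_lt_norm_sum_rankOne_le (hκ : 0 < κ) (hx : ∀ᵐ x ∂ρ.fst, ‖x‖ ^ 2 ≤ κ)
    (hμ : MemLp (fun x : H => x) 2 ρ.fst) {n : ℕ} (hn : 1 ≤ n) {ℓ : ℝ} (hℓ : 0 ≤ ℓ) :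
    (Measure.pi fun _ : Fin n => ρ)
        {z | ¬ ∀ k (hk : k ≤ n) (w : H), ‖∑ j : Fin k, (⟪w, (z (Fin.castLE hk j)).1⟫ •
          (z (Fin.castLE hk j)).1 - (linearOp hμ).adjoint (linearOp hμ w))‖ ≤
            4 * √ℓ * κ * √n * ‖w‖} ≤
      ENNReal.ofReal (Real.exp (1 / 2 - ℓ)) := by
  have hbound : ∀ᵐ z ∂ρ, ‖tensorSquare z.1‖ ≤ κ := by
    simpa only [norm_tensorSquare] using ae_norm_fst_sq_le hx
  have main := measure_exists_le_norm_sum_sub_integral_le stronglyMeasurable_tensorSquare_fst hκ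
    hbound hn hℓ
  refine (measure_mono fun z hz => ?_).trans main
  simp only [Set.mem_ofPred_eq, not_forall, not_le] at hz
  obtain ⟨k, hk, w, hw⟩ := hz
  refine ⟨k, hk, ?_⟩
  have h2 := hw.trans_le (norm_sum_rankOne_sub_le hx hμ (fun j => z (Fin.castLE hk j)) w)
  exact (lt_of_mul_lt_mul_right h2 (norm_nonneg w)).le

/-- Uniform concentration of the partial sums of the vectors `y x`. -/
theorem measure_exists_lt_norm_sum_smul_le (hM : 0 < M) (hκ : 0 < κ) (hy : ∀ᵐ z ∂ρ, |z.2| ≤ M)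
    (hx : ∀ᵐ x ∂ρ.fst, ‖x‖ ^ 2 ≤ κ) {b : H} (hb : ∀ w, ⟪w, b⟫ = ∫ z, ⟪w, z.1⟫ * z.2 ∂ρ)
    {n : ℕ} (hn : 1 ≤ n) {ℓ : ℝ} (hℓ : 0 ≤ ℓ) :
    (Measure.pi fun _ : Fin n => ρ)
        {z | ¬ ∀ k (hk : k ≤ n), ‖∑ j : Fin k, ((z (Fin.castLE hk j)).2 •
          (z (Fin.castLE hk j)).1 - b)‖ ≤ 4 * √ℓ * √κ * M * √n} ≤
      ENNReal.ofReal (Real.exp (1 / 2 - ℓ)) := by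
  have hmeas : StronglyMeasurable fun z : H × ℝ => z.2 • z.1 :=
    (measurable_snd.smul measurable_fst).stronglyMeasurable
  have h0 : ∀ᵐ z ∂ρ, ‖z.2 • z.1‖ ≤ √κ * M := by
    filter_upwards [hy, ae_norm_fst_sq_le hx] with z h1 h2
    rw [norm_smul, mul_comm]
    gcongr
    · exact Real.le_sqrt_of_sq_le h2
    · exact h1
  have hint : Integrable (fun z : H × ℝ => z.2 • z.1) ρ :=
    Integrable.of_bound hmeas.aestronglyMeasurable _ h0
  obtain rfl : b = ∫ z, z.2 • z.1 ∂ρ := by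
    refine ext_inner_left ℝ fun w => ?_
    rw [hb, ← integral_inner hint]
    simp only [real_inner_smul_right, mul_comm]
  have main := measure_exists_le_norm_sum_sub_integral_le hmeas
    (show 0 < √κ * M by positivity) h0 hn hℓ
  rw [← mul_assoc] at main
  refine (measure_mono fun z hz => ?_).trans main
  simp only [Set.mem_ofPred_eq, not_forall, not_le] at hz
  obtain ⟨k, hk, hw⟩ := hz
  exact ⟨k, hk, hw.le⟩

/-- With high probability, all incremental iterates are close to the gradient iterates of the
population. -/
theorem lt_measureReal_norm_iterate_sub_le (hM : 0 < M) (hκ : 0 < κ) (hy : ∀ᵐ z ∂ρ, |z.2| ≤ M)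
    (hx : ∀ᵐ x ∂ρ.fst, ‖x‖ ^ 2 ≤ κ) (hμ : MemLp (fun x : H => x) 2 ρ.fst) {γ : ℝ} (hγ : 0 < γ)
    (hγκ : γ * κ ≤ 1) {b : H} (hb : ∀ w, ⟪w, b⟫ = ∫ z, ⟪w, z.1⟫ * z.2 ∂ρ)
    {Ω : Type*} [MeasurableSpace Ω] (P : Measure Ω) [IsProbabilityMeasure P]
    {n : ℕ} (hn : 1 ≤ n) (Z : Fin n → Ω → H × ℝ)
    (hlaw : ∀ i, HasLaw (Z i) ρ P) (hindep : iIndepFun Z P)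
    {δ : ℝ} (hδ : 0 < δ) (hδ' : δ < 1) :
    1 - δ < P.real {ω | ∀ t : ℕ, ‖linearOp hμ (iterate γ (fun i => Z i ω) 0 t -
      gradientSeq (linearOp hμ) (γ / n) b (n * t))‖ ≤ 32 * Real.log (16 / δ) * M * t / √n} := by
  set ℓ := Real.log (16 / δ) with hℓ
  have hℓ' : 9 / 4 ≤ ℓ := by
    have h1 : Real.log 16 ≤ ℓ :=
      Real.log_le_log (by norm_num) (by rw [le_div_iff₀ hδ]; linarith)
    have h2 : Real.log 16 = 4 * Real.log 2 := by
      rw [show (16 : ℝ) = 2 ^ 4 by norm_num, Real.log_pow]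
      norm_num
    linarith [Real.log_two_gt_d9]
  -- Amounts to `√ℓ ≥ 3 / 2`, which holds because `ℓ ≥ log 16 > 9 / 4`.
  have hsqrt : 12 * (4 * √ℓ) ≤ 32 * ℓ := by
    have h1 : 3 / 2 ≤ √ℓ := Real.le_sqrt_of_sq_le (by linarith)
    nlinarith [Real.mul_self_sqrt (show 0 ≤ ℓ by linarith)]
  have hmap : P.map (fun ω i => Z i ω) = Measure.pi fun _ : Fin n => ρ := by
    rw [iIndepFun.map_fun_eq_pi_map (fun i => (hlaw i).aemeasurable) hindep]
    simp only [(hlaw _).map_eq]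
  have hZ : AEMeasurable (fun ω i => Z i ω) P :=
    aemeasurable_pi_lambda _ fun i => (hlaw i).aemeasurable
  have hA := measure_exists_lt_norm_sum_rankOne_le hκ hx hμ hn (show 0 ≤ ℓ by linarith)
  have hB := measure_exists_lt_norm_sum_smul_le hM hκ hy hx hb hn (show 0 ≤ ℓ by linarith)
  rw [← hmap] at hA hB
  -- This inequality needs no measurability of the bad event; the final passage to the complement
  -- likewise uses only subadditivity.
  have hA' := (Measure.le_map_apply hZ _).trans hA
  have hB' := (Measure.le_map_apply hZ _).trans hB
  have hbdd : ∀ᵐ ω ∂P, ∀ i, ‖(Z i ω).1‖ ^ 2 ≤ κ ∧ |(Z i ω).2| ≤ M := by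
    rw [ae_all_iff]
    intro i
    have h1 : ∀ᵐ z ∂(P.map (Z i)), ‖z.1‖ ^ 2 ≤ κ ∧ |z.2| ≤ M := by
      rw [(hlaw i).map_eq]
      exact (ae_norm_fst_sq_le hx).and hy
    exact ae_of_ae_map (hlaw i).aemeasurable h1
  set good := {ω | ∀ t : ℕ, ‖linearOp hμ (iterate γ (fun i => Z i ω) 0 t -
      gradientSeq (linearOp hμ) (γ / n) b (n * t))‖ ≤ 32 * ℓ * M * t / √n} with hgood
  have hbad : P goodᶜ ≤ ENNReal.ofReal (2 * Real.exp (1 / 2 - ℓ)) := by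
    rw [two_mul, ENNReal.ofReal_add (by positivity) (by positivity)]
    refine le_trans ?_ ((measure_union_le _ _).trans (add_le_add hA' hB'))
    refine measure_mono_ae ?_
    filter_upwards [hbdd] with ω hω hωbad
    by_contra hcon
    change ¬ (_ ∨ _) at hcon
    rw [not_or] at hcon
    refine hωbad fun t => ?_
    have key := norm_iterate_sub_gradientSeq_le (S := linearOp hμ) (b := b) hγ hκ hM.le
      (show 0 ≤ 4 * √ℓ by positivity) hγκ (norm_linearOp_sq_le hμ hκ.le hx) hn
      (z := fun i => Z i ω) (fun i => (hω i).1) (fun i => (hω i).2)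
      (not_not.1 hcon.1) (not_not.1 hcon.2) t
    refine key.trans ?_
    gcongr
  -- The two bad events together have probability at most `2 exp (1 / 2) δ / 16`, and `2 e < 16`.
  have hexp : 2 * Real.exp (1 / 2 - ℓ) < δ := by
    rw [Real.exp_sub, hℓ, Real.exp_log (by positivity)]
    have h1 : Real.exp (1 / 2) ≤ Real.exp 1 := Real.exp_le_exp.2 (by norm_num)
    have h2 := Real.exp_one_lt_d9
    rw [div_div_eq_mul_div, ← mul_div_assoc, div_lt_iff₀ (by norm_num)]
    nlinarith
  have hbad' : P.real goodᶜ < δ :=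
    (ENNReal.toReal_le_of_le_ofReal (by positivity) hbad).trans_lt hexp
  have huniv : (1 : ℝ) ≤ P.real good + P.real goodᶜ := by
    rw [← probReal_univ (μ := P), ← Set.union_compl_self good]
    exact measureReal_union_le _ _
  linarith

end Sampling

/-! ### Sample error and bias combined into a risk bound. -/

section RiskBound

variable {H : Type*} [NormedAddCommGroup H] [InnerProductSpace ℝ H] [CompleteSpace H]
  [SecondCountableTopology H] [MeasurableSpace H] [BorelSpace H]

/-- A risk bound for all iterates simultaneously. -/
theorem lt_measureReal_forall_risk_sub_iInf_le
    (ρ : Measure (H × ℝ)) [IsProbabilityMeasure ρ]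
    {M κ : ℝ} (hM : 0 < M) (hκ : 0 < κ)
    (hy : ∀ᵐ z ∂ρ, |z.2| ≤ M) (hx : ∀ᵐ x ∂ρ.fst, ‖x‖ ^ 2 ≤ κ)
    {γ : ℝ} (hγ : 0 < γ) (hγκ : γ ≤ κ⁻¹) {r : ℝ} (hr : 0 < r)
    (g : Lp ℝ 2 ρ.fst) (hg : SourceCondition ρ r g)
    {Ω : Type*} [MeasurableSpace Ω] (P : Measure Ω) [IsProbabilityMeasure P]
    {n : ℕ} (hn : 1 ≤ n) (Z : Fin n → Ω → H × ℝ)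
    (hlaw : ∀ i, HasLaw (Z i) ρ P) (hindep : iIndepFun Z P)
    {δ : ℝ} (hδ : 0 < δ) (hδ' : δ < 1) :
    1 - δ < P.real {ω | ∀ t : ℕ, 1 ≤ t →
      risk ρ (iterate γ (fun i => Z i ω) 0 t) - ⨅ w : H, risk ρ w ≤
        2 * (32 * Real.log (16 / δ)) ^ 2 / n * (M * t) ^ 2 +
          2 * (r / (γ * t)) ^ (2 * r) * ‖g‖ ^ 2} := by
  have hμ := memLp_id_of_ae_norm_sq_le hx
  have hγκ' : γ * κ ≤ 1 := by
    calc γ * κ ≤ κ⁻¹ * κ := by gcongr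
      _ = 1 := inv_mul_cancel₀ hκ.ne'
  rw [SourceCondition, integralOperator_eq hμ] at hg
  set S := linearOp hμ with hS
  have hn' : (1 : ℝ) ≤ n := by exact_mod_cast hn
  have hn0 : (0 : ℝ) < n := by linarith
  have hηS : γ / n * ‖S‖ ^ 2 ≤ 1 := by
    calc γ / n * ‖S‖ ^ 2 ≤ γ * κ := by
          gcongr
          · exact div_le_self hγ.le hn'
          · exact norm_linearOp_sq_le hμ hκ.le hx
      _ ≤ 1 := hγκ'
  refine (lt_measureReal_norm_iterate_sub_le hM hκ hy hx hμ hγ hγκ' (hg.inner_adjoint hμ hy) P hn Z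
    hlaw hindep hδ hδ').trans_le (measureReal_mono fun ω hω t ht => ?_)
  have ht0 : (0 : ℝ) < t := by exact_mod_cast ht
  set h := fractionalPower (S ∘L S.adjoint) r g with hh
  refine (hg.risk_sub_iInf_le hμ hy _).trans ?_
  have h1 := hω t
  have h2 := norm_pow_fractionalPower_le (S := S) (div_pos hγ hn0) hηS hr
    (Nat.mul_pos hn ht) g
  rw [← norm_neg, ← apply_gradientSeq_sub, ← hh] at h2
  have h3 : γ / n * ((n * t : ℕ) : ℝ) = γ * t := by
    push_cast
    field_simp
  rw [h3] at h2
  set w := iterate γ (fun i => Z i ω) 0 t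
  set v := gradientSeq S (γ / n) (S.adjoint h) (n * t)
  have h4 : ‖S w - h‖ ≤ ‖S (w - v)‖ + ‖S v - h‖ := by
    rw [map_sub]
    exact norm_sub_le_norm_sub_add_norm_sub _ _ _
  have h5 : ‖S (w - v)‖ ^ 2 ≤ (32 * Real.log (16 / δ) * M * t / √n) ^ 2 := by gcongr
  have h6 : ‖S v - h‖ ^ 2 ≤ ((r / (γ * t)) ^ r * ‖g‖) ^ 2 := by gcongr
  have h7 : ‖S w - h‖ ^ 2 ≤ (‖S (w - v)‖ + ‖S v - h‖) ^ 2 := by gcongr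
  have h8 : (32 * Real.log (16 / δ) * M * t / √n) ^ 2 =
      (32 * Real.log (16 / δ)) ^ 2 / n * (M * t) ^ 2 := by
    rw [div_pow, Real.sq_sqrt hn0.le]
    ring
  have h9 : ((r / (γ * t)) ^ r * ‖g‖) ^ 2 = (r / (γ * t)) ^ (2 * r) * ‖g‖ ^ 2 := by
    rw [mul_pow, mul_comm 2 r, Real.rpow_mul (by positivity), Real.rpow_two]
  rw [h8] at h5
  rw [h9] at h6
  rw [mul_div_assoc, mul_assoc, mul_assoc 2 ((r / (γ * t)) ^ (2 * r))]
  nlinarith [sq_nonneg (‖S (w - v)‖ - ‖S v - h‖)]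

theorem stoppingRule_bounds {n : ℕ} (hn : 1 ≤ n) :
    1 ≤ stoppingRule n ∧ (n : ℝ) ^ (1 / 3 : ℝ) ≤ stoppingRule n ∧
      (stoppingRule n : ℝ) ≤ 2 * (n : ℝ) ^ (1 / 3 : ℝ) := by
  have h1 : (1 : ℝ) ≤ (n : ℝ) ^ (1 / 3 : ℝ) :=
    Real.one_le_rpow (by exact_mod_cast hn) (by norm_num)
  refine ⟨Nat.ceil_pos.2 (by linarith), Nat.le_ceil _, ?_⟩
  have h2 := Nat.ceil_lt_add_one (show 0 ≤ (n : ℝ) ^ (1 / 3 : ℝ) by linarith)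
  rw [stoppingRule]
  linarith

end RiskBound

end IncrementalLearning

/-! ### The two claimed bounds, deduced from the sharper one. -/

open IncrementalLearning in
theorem mainTheorem4
    {H : Type*} [NormedAddCommGroup H] [InnerProductSpace ℝ H] [CompleteSpace H]
    [SecondCountableTopology H] [MeasurableSpace H] [BorelSpace H]
    (ρ : Measure (H × ℝ)) [IsProbabilityMeasure ρ]
    {M κ : ℝ} (hM : 0 < M) (hκ : 0 < κ)
    (hy : ∀ᵐ z ∂ρ, |z.2| ≤ M) (hx : ∀ᵐ x ∂ρ.fst, ‖x‖ ^ 2 ≤ κ)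
    {γ : ℝ} (hγ : 0 < γ) (hγκ : γ ≤ κ⁻¹)
    {r : ℝ} (hr : 0 < r) (hr' : r ≤ 1 / 2)
    (g : Lp ℝ 2 ρ.fst) (hg : SourceCondition ρ r g)
    {Ω : Type*} [MeasurableSpace Ω] (P : Measure Ω) [IsProbabilityMeasure P]
    {n : ℕ} (hn : 1 ≤ n) (Z : Fin n → Ω → H × ℝ)
    (hlaw : ∀ i, HasLaw (Z i) ρ P) (hindep : iIndepFun Z P)
    {δ : ℝ} (hδ : 0 < δ) (hδ' : δ < 1) :
    (∀ t : ℕ, 1 ≤ t →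
      1 - δ < P.real {ω |
        risk ρ (iterate γ (fun i => Z i ω) 0 t) - ⨅ w : H, risk ρ w ≤
          8 * (32 * Real.log (16 / δ)) ^ 2 / n *
            ((M + 2 * M ^ 2 * κ ^ (-(1 / 2) : ℝ) + 6 * ‖g‖ * κ ^ (-(1 / 2) : ℝ) / (3 - 2 * r)) *
                (t : ℝ) ^ (3 / 2 - r) +
              3 * κ ^ r * ((1 - 2 * r) / (3 - 2 * r)) * ‖g‖) ^ 2 +
          2 * (r / (γ * t)) ^ (2 * r) * ‖g‖ ^ 2}) ∧
    1 - δ < P.real {ω |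
      risk ρ (iterate γ (fun i => Z i ω) 0 (stoppingRule n)) - ⨅ w : H, risk ρ w ≤
        (8 * (32 * Real.log (16 / δ)) ^ 2 *
            (M + 2 * M ^ 2 * κ ^ (-(1 / 2) : ℝ) + 6 * ‖g‖ / (3 - 2 * r) +
              (3 - 6 * r) / (3 - 2 * r) * κ ^ r * ‖g‖) ^ 2 +
          2 * (r / γ) ^ (2 * r) * ‖g‖ ^ 2) * (n : ℝ) ^ (-(2 * r) / 3)} := by
  have key := lt_measureReal_forall_risk_sub_iInf_le ρ hM hκ hy hx hγ hγκ hr g hg P hn Z hlaw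
    hindep hδ hδ'
  have h32 : 0 < 3 - 2 * r := by linarith
  have h12 : 0 ≤ 1 - 2 * r := by linarith
  have h36 : 0 ≤ 3 - 6 * r := by linarith
  refine ⟨fun t ht => key.trans_le (measureReal_mono fun ω hω => (hω t ht).trans ?_),
    key.trans_le (measureReal_mono fun ω hω => ?_)⟩
  · have ht1 : (1 : ℝ) ≤ t := by exact_mod_cast ht
    have h1 : (t : ℝ) ≤ (t : ℝ) ^ (3 / 2 - r) := by
      simpa using Real.rpow_le_rpow_of_exponent_le ht1 (show (1 : ℝ) ≤ 3 / 2 - r by linarith)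
    gcongr
    · norm_num
    · have h2 : 0 ≤ 2 * M ^ 2 * κ ^ (-(1 / 2) : ℝ) := by positivity
      have h3 : 0 ≤ 6 * ‖g‖ * κ ^ (-(1 / 2) : ℝ) / (3 - 2 * r) := by positivity
      have h4 : 0 ≤ 3 * κ ^ r * ((1 - 2 * r) / (3 - 2 * r)) * ‖g‖ := by positivity
      refine le_add_of_le_of_nonneg ?_ h4
      gcongr
      linarith
  · obtain ⟨ht, hlow, hup⟩ := stoppingRule_bounds hn
    refine (hω _ ht).trans ?_
    have hn1 : (1 : ℝ) ≤ n := by exact_mod_cast hn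
    have hn0 : (0 : ℝ) < n := by linarith
    set t : ℝ := ((stoppingRule n : ℕ) : ℝ)
    have ht0 : 0 < t := lt_of_lt_of_le (by positivity) hlow
    rw [add_mul]
    refine add_le_add ?_ ?_
    -- From `t ≤ 2 n ^ (1/3)` the ratio is at most `4 n ^ (-1/3)`, and `2 r ≤ 1` weakens the
    -- exponent. The `4` turns the leading `2` into the claimed `8`.
    · have h1 : t ^ 2 / n ≤ 4 * (n : ℝ) ^ (-(2 * r) / 3) := by
        calc t ^ 2 / n ≤ (2 * (n : ℝ) ^ (1 / 3 : ℝ)) ^ 2 / n := by gcongr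
          _ = 4 * (n : ℝ) ^ (-(1 / 3) : ℝ) := by
            rw [mul_pow, ← Real.rpow_natCast ((n : ℝ) ^ (1 / 3 : ℝ)), ← Real.rpow_mul hn0.le,
              mul_div_assoc, ← Real.rpow_sub_one hn0.ne']
            norm_num
          _ ≤ _ := by
            gcongr 4 * ?_
            exact Real.rpow_le_rpow_of_exponent_le hn1 (by linarith)
      have h2 : 0 ≤ 2 * M ^ 2 * κ ^ (-(1 / 2) : ℝ) := by positivity
      have h3 : 0 ≤ 6 * ‖g‖ / (3 - 2 * r) := by positivity
      have h4 : 0 ≤ (3 - 6 * r) / (3 - 2 * r) * κ ^ r * ‖g‖ := by positivity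
      calc _ = 2 * (32 * Real.log (16 / δ)) ^ 2 * M ^ 2 * (t ^ 2 / n) := by ring
        _ ≤ 2 * (32 * Real.log (16 / δ)) ^ 2 * M ^ 2 * (4 * (n : ℝ) ^ (-(2 * r) / 3)) := by
          gcongr
        _ = 8 * (32 * Real.log (16 / δ)) ^ 2 * M ^ 2 * (n : ℝ) ^ (-(2 * r) / 3) := by ring
        _ ≤ _ := by
          gcongr
          linarith
    · have h5 : (r / (γ * t)) ^ (2 * r) ≤ (r / γ) ^ (2 * r) * (n : ℝ) ^ (-(2 * r) / 3) := by
        calc (r / (γ * t)) ^ (2 * r) ≤ (r / γ * (n : ℝ) ^ (-(1 / 3) : ℝ)) ^ (2 * r) := by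
              gcongr
              rw [Real.rpow_neg hn0.le, ← div_eq_mul_inv, div_div]
              gcongr
          _ = _ := by
              rw [Real.mul_rpow (by positivity) (by positivity), ← Real.rpow_mul hn0.le]
              congr 2
              ring
      calc _ ≤ 2 * ((r / γ) ^ (2 * r) * (n : ℝ) ^ (-(2 * r) / 3)) * ‖g‖ ^ 2 := by gcongr
        _ = _ := by ring
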